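/- Let $T$ be a set with a $\sigma$-algebra $\mathcal A$, let $X$ be a real Banach space, and let $\mu:\mathcal A\to[0,\infty)$ be a set function with $\mu(\emptyset)=0$ such that - $\mu$ is monotone: $\mu(A)\le\mu(B)$ whenever $A\subseteq B$ in $\mathcal A$; - $\mu$ is integrable: the sums $\sum_{i=1}^n\mu(A_i)$, taken over the finite partitions $\{A_1,\dots,A_n\}$ of $T$ into nonempty sets of $\mathcal A$ directed by refinement, have a finite limit; - $\mu$ is continuous from below: $\mu(A_n)\to\mu(\bigcup_nA_n)$ for every increasing sequence $(A_n)_n$ in $\mathcal A$. Let $cwk(X)$ be the family of nonempty convex weakly compact subsets of $X$, and let $h$ be the Hausdorff distance. A partition $P'$ is finer than $P$ if every set of $P'$ is contained in some set of $P$. Countable means at most countable, and $\sum$ of finitely many sets means the norm closure of their Minkowski sum. For a multifunction $F:T\to cwk(X)$ define: - Let $\mathcal C$ be a family of nonempty bounded subsets of $X$. Then $F$ is *simple Birkhoff integrable in $\mathcal C$* with respect to $\mu$ if there is a closed set $I\in\mathcal C$ such that for every $\varepsilon>0$ there is a countable partition $P_\varepsilon\subseteq\mathcal A$ of $T$ such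 that $\limsup_n h\big(\sum_{i=1}^nF(t_i)\mu(A_i),I\big)\le\varepsilon$ for every (enumerated) countable partition $\{A_n\}\subseteq\mathcal A$ of $T$ finer than $P_\varepsilon$ and every choice of points $t_n\in A_n$. - $F$ is *Gould integrable* with respect to $\mu$ if there is a nonempty bounded closed set $I\subseteq X$ such that for every $\varepsilon>0$ there is a finite partition $P_\varepsilon\subseteq\mathcal A$ of $T$ such that $h\big(\sum_{i=1}^nF(t_i)\mu(A_i),I\big)<\varepsilon$ for every finite partition $\{A_1,\dots,A_n\}\subseteq\mathcal A$ of $T$ finer than $P_\varepsilon$ and every choice of points $t_i\in A_i$. - $F$ is *Birkhoff integrable* with respect to $\mu$ if the function $f=j\circ F$ is, where $j:cwk(X)\to\ell^\infty(B_{X^*})$, $j(A)(x^*)=\sup_{x\in A}x^*(x)$, is the Rådström embedding; that is, for every $\varepsilon>0$ there is a countable partition $\{A_n\}\subseteq\mathcal A$ of $T$ such that all the series $\sum_n\mu(A_n)f(t_n)$ with $t_n\in A_n$ are unconditionally convergent and the set of their sums has diameter at most $\varepsilon$. Let $F:T\to cwk(X)$ be bounded, that is, $\sup\{\|x\|:x\in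 F(t),\ t\in T\}<\infty$, and let $\mathcal C$ be any family of nonempty bounded subsets of $X$ with $cwk(X)\subseteq\mathcal C$. Then $F$ is simple Birkhoff integrable in $\mathcal C$ with respect to $\mu$ if and only if it is Birkhoff integrable with respect to $\mu$, and if and only if it is Gould integrable with respect to $\mu$. -/

import Mathlib

open Set Filter Topology
open scoped NNReal ENNReal Pointwise

noncomputable section

section SetFunctions

variable {T : Type*} [MeasurableSpace T]

/-- A finite partition of `T` into nonempty measurable sets. -/
structure IsFinitePartition {n : ℕ} (A : Fin n → Set T) : Prop where
  measurableSet : ∀ i, MeasurableSet (A i)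
  nonempty : ∀ i, (A i).Nonempty
  disjoint : Pairwise fun i j => Disjoint (A i) (A j)
  iUnion_eq : ⋃ i, A i = univ

/-- An (at most) countable partition of `T` into measurable sets, enumerated by `ℕ`. Some of the
`A n` may be empty, so that the partitions with finitely many nonempty members are included; the
empty members have measure zero and play no role. -/
structure IsCountablePartition (A : ℕ → Set T) : Prop where
  measurableSet : ∀ n, MeasurableSet (A n)
  disjoint : Pairwise fun m n => Disjoint (A m) (A n)
  iUnion_eq : ⋃ n, A n = univ

/-- The family `A` is finer than the family `B`: every set of `A` lies in some set of `B`. -/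
def IsFiner {T ι κ : Type*} (A : ι → Set T) (B : κ → Set T) : Prop :=
  ∀ i, ∃ j, A i ⊆ B j

/-- `t` is a choice of points `t i ∈ A i`, for all `i` with `A i` nonempty. -/
def IsTagging {T ι : Type*} (A : ι → Set T) (t : ι → T) : Prop :=
  ∀ i, (A i).Nonempty → t i ∈ A i

/-- `μ` (used on measurable sets only) is monotone. -/
def IsMonotoneSetFunction (μ : Set T → ℝ≥0) : Prop :=
  ∀ A B : Set T, MeasurableSet A → MeasurableSet B → A ⊆ B → μ A ≤ μ B

/-- `μ` (used on measurable sets only) is continuous from below. -/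
def IsContinuousFromBelow (μ : Set T → ℝ≥0) : Prop :=
  ∀ A : ℕ → Set T, (∀ n, MeasurableSet (A n)) → Monotone A →
    Tendsto (fun n => μ (A n)) atTop (𝓝 (μ (⋃ n, A n)))

/-- `μ` is integrable: the sums `∑ i, μ (A i)` over the finite partitions of `T`, ordered by
refinement, have a finite limit. -/
def IsIntegrableSetFunction (μ : Set T → ℝ≥0) : Prop :=
  ∃ L : ℝ, ∀ ε : ℝ, 0 < ε → ∃ (m : ℕ) (P : Fin m → Set T), IsFinitePartition P ∧
    ∀ (n : ℕ) (A : Fin n → Set T), IsFinitePartition A → IsFiner A P →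
      |∑ i, (μ (A i) : ℝ) - L| < ε

/-- Birkhoff integrability of a vector valued function `f`: for every `ε > 0` there is a countable
partition such that, for every choice of tags, the series `∑ μ (A n) f (t n)` converges
unconditionally, and the set of all these sums has diameter at most `ε`. -/
def BirkhoffIntegrable {E : Type*} [NormedAddCommGroup E] [NormedSpace ℝ E]
    (μ : Set T → ℝ≥0) (f : T → E) : Prop :=
  ∀ ε : ℝ, 0 < ε → ∃ A : ℕ → Set T, IsCountablePartition A ∧
    (∀ t : ℕ → T, IsTagging A t → Summable fun n => (μ (A n) : ℝ) • f (t n)) ∧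
    ∀ s t : ℕ → T, IsTagging A s → IsTagging A t →
      dist (∑' n, (μ (A n) : ℝ) • f (s n)) (∑' n, (μ (A n) : ℝ) • f (t n)) ≤ ε

end SetFunctions

section Hyperspaces

variable (X : Type*) [NormedAddCommGroup X] [NormedSpace ℝ X]

/-- `b(X)`: the nonempty bounded subsets of `X`. -/
def bSets : Set (Set X) := {A | A.Nonempty ∧ Bornology.IsBounded A}

/-- `bf(X)`: the nonempty bounded closed subsets of `X`. -/
def bfSets : Set (Set X) := {A | A.Nonempty ∧ Bornology.IsBounded A ∧ IsClosed A}

/-- `cwk(X)`: the nonempty convex weakly compact subsets of `X`. -/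
def cwkSets : Set (Set X) :=
  {A | A.Nonempty ∧ Convex ℝ A ∧ IsCompact (toWeakSpace ℝ X '' A)}

variable {X}

theorem exists_bound_of_mem_cwkSets {A : Set X} (hA : A ∈ cwkSets X) :
    ∃ M : ℝ, ∀ x ∈ A, ‖x‖ ≤ M := by
  obtain ⟨-, -, hc⟩ := hA
  have key : ∃ C, ∀ a : A, ‖NormedSpace.inclusionInDoubleDual ℝ X (a : X)‖ ≤ C := by
    apply banach_steinhaus
    intro φ
    have hcont : Continuous fun y : WeakSpace ℝ X => φ ((toWeakSpace ℝ X).symm y) :=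
      WeakBilin.eval_continuous _ φ
    obtain ⟨C, hC⟩ := (hc.image hcont).isBounded.exists_norm_le
    refine ⟨C, fun a => hC _ ⟨_, mem_image_of_mem _ a.2, ?_⟩⟩
    simp [NormedSpace.dual_def]
  obtain ⟨C, hC⟩ := key
  refine ⟨C, fun x hx => ?_⟩
  have := hC ⟨x, hx⟩
  rwa [show ‖NormedSpace.inclusionInDoubleDual ℝ X x‖ = ‖x‖ from
    (NormedSpace.inclusionInDoubleDualLi ℝ (E := X)).norm_map x] at this

/-- The support function of `A ∈ cwk(X)` on the closed unit ball of the dual, `φ ↦ sup φ(A)`. -/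
def supportFun (A : cwkSets X) (φ : Metric.closedBall (0 : StrongDual ℝ X) 1) : ℝ :=
  sSup ((φ : StrongDual ℝ X) '' (A : Set X))

theorem memlp_supportFun (A : cwkSets X) : Memℓp (supportFun A) ∞ := by
  obtain ⟨M, hM⟩ := exists_bound_of_mem_cwkSets A.2
  apply memℓp_infty
  refine ⟨M, ?_⟩
  rintro _ ⟨φ, rfl⟩
  have hφ : ‖(φ : StrongDual ℝ X)‖ ≤ 1 := mem_closedBall_zero_iff.1 φ.2
  have hb : ∀ x ∈ (A : Set X), |(φ : StrongDual ℝ X) x| ≤ M := fun x hx =>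
    ((φ : StrongDual ℝ X).le_of_opNorm_le hφ x).trans (by simpa using hM x hx)
  obtain ⟨x₀, hx₀⟩ := A.2.1
  change |sSup _| ≤ M
  rw [abs_le]
  constructor
  · refine (neg_le_of_abs_le (hb x₀ hx₀)).trans (le_csSup ⟨M, ?_⟩ (mem_image_of_mem _ hx₀))
    rintro _ ⟨x, hx, rfl⟩
    exact (le_abs_self _).trans (hb x hx)
  · refine csSup_le ⟨_, mem_image_of_mem _ hx₀⟩ ?_
    rintro _ ⟨x, hx, rfl⟩
    exact (le_abs_self _).trans (hb x hx)

/-- The Rådström embedding `j : cwk(X) → ℓ^∞(B_{X*})`, which sends `A` to its support function. -/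
def radstrom (A : cwkSets X) : lp (fun _ : Metric.closedBall (0 : StrongDual ℝ X) 1 => ℝ) ∞ :=
  ⟨supportFun A, memlp_supportFun A⟩

end Hyperspaces

section Multifunctions

variable {T : Type*} [MeasurableSpace T] {X : Type*} [NormedAddCommGroup X] [NormedSpace ℝ X]

/-- `F` is bounded: `sup {‖x‖ : x ∈ F t, t ∈ T} < ∞`. -/
def IsBoundedMultifunction {T : Type*} (F : T → Set X) : Prop :=
  ∃ M : ℝ, ∀ t, ∀ x ∈ F t, ‖x‖ ≤ M

/-- The sum of finitely many sets: the norm closure of the Minkowski sum. -/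
def closedSum {ι : Type*} (s : Finset ι) (A : ι → Set X) : Set X :=
  closure (∑ i ∈ s, A i)

/-- Gould integrability of the multifunction `F` with respect to `μ`. -/
def GouldIntegrable (μ : Set T → ℝ≥0) (F : T → Set X) : Prop :=
  ∃ I ∈ bfSets X, ∀ ε : ℝ, 0 < ε → ∃ (m : ℕ) (P : Fin m → Set T), IsFinitePartition P ∧
    ∀ (n : ℕ) (A : Fin n → Set T), IsFinitePartition A → IsFiner A P →
      ∀ t : Fin n → T, IsTagging A t →
        Metric.hausdorffEDist (closedSum Finset.univ fun i => (μ (A i) : ℝ) • F (t i)) I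
          < ENNReal.ofReal ε

/-- Birkhoff simple integrability of the multifunction `F` in the family `𝒞` with respect to
`μ`. -/
def BirkhoffSimpleIntegrable (𝒞 : Set (Set X)) (μ : Set T → ℝ≥0) (F : T → Set X) : Prop :=
  ∃ I ∈ 𝒞, IsClosed I ∧ ∀ ε : ℝ, 0 < ε → ∃ P : ℕ → Set T, IsCountablePartition P ∧
    ∀ A : ℕ → Set T, IsCountablePartition A → IsFiner A P →
      ∀ t : ℕ → T, IsTagging A t →
        limsup (fun n => Metric.hausdorffEDist
            (closedSum (Finset.range n) fun i => (μ (A i) : ℝ) • F (t i)) I) atTop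
          ≤ ENNReal.ofReal ε

/-- Birkhoff integrability of a `cwk(X)`-valued multifunction: its composition with the Rådström
embedding is Birkhoff integrable. -/
def BirkhoffIntegrableMulti (μ : Set T → ℝ≥0) (F : T → cwkSets X) : Prop :=
  BirkhoffIntegrable μ fun t => radstrom (F t)

end Multifunctions

end

/-! Although `μ` is not additive, it may be replaced by a finite measure. For measurable `E`, the
sums of `μ (A i ∩ E)` over finite partitions converge under refinement, uniformly in `E`, to a value
`N E`. This `N` is additive because fine partitions respect any given set, and it inherits
continuity from below through the uniform limit. Hence `N` is a finite measure `ν`, and on all fine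
enough partitions, countable ones included, the total variation of `μ - ν` is at most `ε`
(`exists_isApproximatedBy`). For bounded integrands, sums against `μ` then differ little from sums
against `ν`, which are integrals of step functions.

On the side of the values, `A ↦ supOn A` on the dual unit ball turns Minkowski sums into sums and
the Hausdorff distance into the sup distance (Hahn-Banach), and `cwkSets X` is complete. The problem
becomes one about a uniformly bounded family of real functions, the support functions of `F`, with
estimates uniform over the family.

Birkhoff integrability makes the weighted oscillations of this family small on one countable
partition. Cutting off a tail of small `ν`-measure gives a finite partition with the same property
(`hasSmallOscillation_of_forall_exists`). Sums over all refinements of it, finite or countable, are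
then close to one another, so by completeness they share a limit `I` in `cwkSets X`
(`exists_isPartitionLimit`); this `I` is the integral in both the simple Birkhoff and the Gould
sense. Conversely, under either of these, two taggings of one fine partition give sums close to the
same set, hence close to each other, which is the Birkhoff condition. -/

noncomputable section

/-! ### Partitions as fibres of index functions. -/

section IndexFunctions

variable {T : Type*}

/-- The index function `q` refines `p`: the fibres of `q` lie in fibres of `p`. -/
def IndexRefines {T ι κ : Type*} (q : T → ι) (p : T → κ) : Prop :=
  ∀ x y, q x = q y → p x = p y

/-- The fibres of `q` are measurable. -/
def HasMeasurableFibers [MeasurableSpace T] {ι : Type*} (q : T → ι) : Prop :=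
  ∀ i, MeasurableSet (q ⁻¹' {i})

/-- Pairing index functions is the common refinement of partitions; this is the gain from working
with functions instead of families of sets. -/
theorem HasMeasurableFibers.prodMk [MeasurableSpace T] {ι κ : Type*} {q : T → ι} {p : T → κ}
    (hq : HasMeasurableFibers q) (hp : HasMeasurableFibers p) :
    HasMeasurableFibers fun x => (q x, p x) := by
  rintro ⟨i, j⟩
  have : (fun x => (q x, p x)) ⁻¹' {(i, j)} = q ⁻¹' {i} ∩ p ⁻¹' {j} := by
    ext x; simp
  rw [this]
  exact (hq i).inter (hp j)

theorem HasMeasurableFibers.measurableSet_preimage [MeasurableSpace T] {ι : Type*} [Countable ι]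
    {q : T → ι} (hq : HasMeasurableFibers q) (S : Set ι) : MeasurableSet (q ⁻¹' S) := by
  rw [← biUnion_preimage_singleton]
  exact MeasurableSet.biUnion S.to_countable fun i _ => hq i

theorem IndexRefines.fst {ι κ : Type*} (q : T → ι) (p : T → κ) :
    IndexRefines (fun x => (q x, p x)) q := fun _ _ h => (Prod.ext_iff.1 h).1

theorem IndexRefines.snd {ι κ : Type*} (q : T → ι) (p : T → κ) :
    IndexRefines (fun x => (q x, p x)) p := fun _ _ h => (Prod.ext_iff.1 h).2

theorem IndexRefines.trans {ι κ l : Type*} {q : T → ι} {p : T → κ} {r : T → l}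
    (h : IndexRefines q p) (h' : IndexRefines p r) : IndexRefines q r :=
  fun x y hxy => h' x y (h x y hxy)

theorem exists_index {ι : Type*} {A : ι → Set T} (hd : Pairwise fun i j => Disjoint (A i) (A j))
    (hu : ⋃ i, A i = univ) : ∃ q : T → ι, ∀ i, A i = q ⁻¹' {i} := by
  have h : ∀ x, ∃ i, x ∈ A i := fun x => by
    have : x ∈ ⋃ i, A i := hu ▸ mem_univ x
    simpa using this
  choose q hq using h
  refine ⟨q, fun i => ?_⟩
  ext x
  refine ⟨fun hx => ?_, fun hx => ?_⟩
  · by_contra hne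
    exact (Set.disjoint_left.1 (hd hne) (hq x)) hx
  · have : q x = i := hx
    exact this ▸ hq x

theorem indexRefines_of_isFiner {ι κ : Type*} {q : T → ι} {p : T → κ}
    (h : IsFiner (fun i => q ⁻¹' {i}) fun j => p ⁻¹' {j}) : IndexRefines q p := by
  intro x y hxy
  obtain ⟨j, hj⟩ := h (q x)
  have h1 : p x = j := hj rfl
  have h2 : p y = j := hj (show q y = q x from hxy.symm)
  rw [h1, h2]

theorem isFiner_of_indexRefines {ι κ : Type*} [Nonempty κ] {q : T → ι} {p : T → κ}
    (h : IndexRefines q p) : IsFiner (fun i => q ⁻¹' {i}) fun j => p ⁻¹' {j} := by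
  intro i
  by_cases hi : ∃ x, q x = i
  · obtain ⟨x, rfl⟩ := hi
    exact ⟨p x, fun y hy => h y x hy⟩
  · exact ⟨Classical.arbitrary κ, fun y hy => (hi ⟨y, hy⟩).elim⟩

variable [MeasurableSpace T]

theorem IsFinitePartition.exists_index {n : ℕ} {A : Fin n → Set T} (hA : IsFinitePartition A) :
    ∃ q : T → Fin n, HasMeasurableFibers q ∧ A = fun i => q ⁻¹' {i} := by
  obtain ⟨q, hq⟩ := _root_.exists_index hA.disjoint hA.iUnion_eq
  exact ⟨q, fun i => hq i ▸ hA.measurableSet i, funext hq⟩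

theorem IsCountablePartition.exists_index {A : ℕ → Set T} (hA : IsCountablePartition A) :
    ∃ q : T → ℕ, HasMeasurableFibers q ∧ A = fun i => q ⁻¹' {i} := by
  obtain ⟨q, hq⟩ := _root_.exists_index hA.disjoint hA.iUnion_eq
  exact ⟨q, fun i => hq i ▸ hA.measurableSet i, funext hq⟩

theorem HasMeasurableFibers.isCountablePartition {q : T → ℕ} (hq : HasMeasurableFibers q) :
    IsCountablePartition fun i => q ⁻¹' {i} where
  measurableSet := hq
  disjoint i j hij := by
    refine Set.disjoint_left.2 ?_
    rintro x rfl hx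
    exact hij hx
  iUnion_eq := by ext x; simp

/-- The nonempty fibres of a finite index function, enumerated. -/
theorem HasMeasurableFibers.exists_isFinitePartition {ι : Type*} [Fintype ι] {q : T → ι}
    (hq : HasMeasurableFibers q) :
    ∃ (n : ℕ) (e : Fin n → ι), Function.Injective e ∧ range e = range q ∧
      IsFinitePartition fun i => q ⁻¹' {e i} := by
  classical
  let E := Fintype.equivFin (range q)
  refine ⟨_, fun i => (E.symm i : ι), ?_, ?_, ?_, ?_, ?_, ?_⟩
  · exact Subtype.val_injective.comp E.symm.injective
  · ext i
    constructor
    · rintro ⟨j, rfl⟩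
      exact (E.symm j).2
    · intro hi
      exact ⟨E ⟨i, hi⟩, by simp⟩
  · exact fun i => hq _
  · intro i
    obtain ⟨x, hx⟩ := (E.symm i).2
    exact ⟨x, hx⟩
  · intro i j hij
    rw [Set.disjoint_left]
    intro x hx hx'
    have h1 : q x = (E.symm i : ι) := hx
    have h2 : q x = (E.symm j : ι) := hx'
    exact hij (E.symm.injective (Subtype.ext (h1.symm.trans h2)))
  · ext x
    simp only [mem_iUnion, mem_preimage, mem_singleton_iff, mem_univ, iff_true]
    exact ⟨E ⟨q x, x, rfl⟩, by simp⟩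

/-- The sum of `μ` over the traces on `E` of the fibres of `q`. -/
def fiberSum (μ : Set T → ℝ≥0) {ι : Type*} [Fintype ι] (q : T → ι) (E : Set T) : ℝ :=
  ∑ i, (μ (q ⁻¹' {i} ∩ E) : ℝ)

/-- Empty fibres contribute nothing since `μ ∅ = 0`, so the nonemptiness demanded of finite
partitions can be dropped and any finite index type used. -/
theorem IsIntegrableSetFunction.exists_fiberSum {μ : Set T → ℝ≥0} (hμ_empty : μ ∅ = 0)
    (hμ : IsIntegrableSetFunction μ) :
    ∃ L : ℝ, ∀ ε : ℝ, 0 < ε → ∃ (k : ℕ) (p : T → Fin k), HasMeasurableFibers p ∧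
      ∀ (ι : Type) [Fintype ι] (q : T → ι), HasMeasurableFibers q → IndexRefines q p →
        |∑ i, (μ (q ⁻¹' {i}) : ℝ) - L| < ε := by
  obtain ⟨L, hL⟩ := hμ
  refine ⟨L, fun ε hε => ?_⟩
  obtain ⟨k, P, hP, h⟩ := hL ε hε
  obtain ⟨p, hp, rfl⟩ := hP.exists_index
  refine ⟨k, p, hp, fun ι _ q hq hqp => ?_⟩
  obtain ⟨n, e, he, her, hpart⟩ := hq.exists_isFinitePartition
  have hfin : IsFiner (fun i => q ⁻¹' {e i}) fun j => p ⁻¹' {j} := by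
    intro i
    obtain ⟨x, hx⟩ := hpart.nonempty i
    exact ⟨p x, fun y hy => hqp y x (hy.trans (Eq.symm hx))⟩
  have := h n _ hpart hfin
  have hs : ∑ i, (μ (q ⁻¹' {e i}) : ℝ) = ∑ i, (μ (q ⁻¹' {i}) : ℝ) := by
    refine Fintype.sum_of_injective e he _ _ (fun i hi => ?_) fun _ => rfl
    have : q ⁻¹' {i} = ∅ := preimage_singleton_eq_empty.2 (her ▸ hi)
    simp [this, hμ_empty]
  rwa [hs] at this

end IndexFunctions

/-! ### The measure underlying an integrable set function. -/

section LimitMeasure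

variable {T : Type*} [MeasurableSpace T] {μ : Set T → ℝ≥0}

/-- The function `N` is the limit of the sums of `μ` along finite measurable partitions. -/
def IsFiberLimit (μ : Set T → ℝ≥0) (N : Set T → ℝ) : Prop :=
  ∀ ε : ℝ, 0 < ε → ∃ (k : ℕ) (p : T → Fin k), HasMeasurableFibers p ∧
    ∀ (ι : Type) [Fintype ι] (q : T → ι), HasMeasurableFibers q → IndexRefines q p →
      ∀ E, MeasurableSet E → |fiberSum μ q E - N E| ≤ ε

/-- Gluing `q` on `E` with `p` on the complement gives a refinement of `p`, whose total sum is
within `ε` of `L`. The same holds for `r`, and the parts outside `E` cancel. The bound does not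
depend on `E`. -/
theorem fiberSum_sub_lt {L ε : ℝ} {k : ℕ} {p : T → Fin k}
    (hp : HasMeasurableFibers p)
    (h : ∀ (ι : Type) [Fintype ι] (q : T → ι), HasMeasurableFibers q → IndexRefines q p →
        |∑ i, (μ (q ⁻¹' {i}) : ℝ) - L| < ε)
    {ι κ : Type} [Fintype ι] [Fintype κ] {q : T → ι} {r : T → κ}
    (hq : HasMeasurableFibers q) (hqp : IndexRefines q p)
    (hr : HasMeasurableFibers r) (hrp : IndexRefines r p) {E : Set T} (hE : MeasurableSet E) :
    |fiberSum μ q E - fiberSum μ r E| < 2 * ε := by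
  classical
  have key : ∀ (l : Type) [Fintype l] (q : T → l), HasMeasurableFibers q → IndexRefines q p →
      |fiberSum μ q E + fiberSum μ p Eᶜ - L| < ε := by
    intro l _ q hq hqp
    let m : T → l ⊕ Fin k := fun x => if x ∈ E then Sum.inl (q x) else Sum.inr (p x)
    have hl : ∀ i, m ⁻¹' {Sum.inl i} = q ⁻¹' {i} ∩ E := by
      intro i; ext x
      by_cases hx : x ∈ E <;> simp [m, hx]
    have hr : ∀ i, m ⁻¹' {Sum.inr i} = p ⁻¹' {i} ∩ Eᶜ := by
      intro i; ext x
      by_cases hx : x ∈ E <;> simp [m, hx]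
    have hm : HasMeasurableFibers m := by
      rintro (i | i)
      · rw [hl]; exact (hq i).inter hE
      · rw [hr]; exact (hp i).inter hE.compl
    have hmp : IndexRefines m p := by
      intro x y hxy
      by_cases hx : x ∈ E <;> by_cases hy : y ∈ E <;> simp [m, hx, hy] at hxy
      · exact hqp x y hxy
      · exact hxy
    have := h _ m hm hmp
    rw [Fintype.sum_sum_type] at this
    simp only [hl, hr] at this
    exact this
  have h1 := abs_lt.1 (key ι q hq hqp)
  have h2 := abs_lt.1 (key κ r hr hrp)
  rw [abs_lt]
  constructor <;> linarith [h1.1, h1.2, h2.1, h2.2]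

/-- Along the common refinements `r n` of the first `n + 1` partitions the sums are Cauchy uniformly
in `E`, by `fiberSum_sub_lt`; the limit keeps this uniformity. -/
theorem exists_isFiberLimit (hμ_empty : μ ∅ = 0) (hμ : IsIntegrableSetFunction μ) :
    ∃ N, IsFiberLimit μ N := by
  obtain ⟨L, hL⟩ := hμ.exists_fiberSum hμ_empty
  choose k p hp h using fun n : ℕ => hL (1 / ((n : ℝ) + 1)) (by positivity)
  let r : (n : ℕ) → T → ((i : Fin (n + 1)) → Fin (k i)) := fun n x i => p i x
  have hr : ∀ n, HasMeasurableFibers (r n) := by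
    intro n g
    have : r n ⁻¹' {g} = ⋂ i : Fin (n + 1), p i ⁻¹' {g i} := by
      ext x
      simp [r, funext_iff]
    rw [this]
    exact MeasurableSet.iInter fun i => hp i _
  have hrp : ∀ m n, m ≤ n → IndexRefines (r n) (p m) := by
    intro m n hmn x y hxy
    exact congrFun hxy ⟨m, Nat.lt_succ_of_le hmn⟩
  have hclose : ∀ m n, m ≤ n → ∀ (ι : Type) [Fintype ι] (q : T → ι), HasMeasurableFibers q →
      IndexRefines q (p m) → ∀ E, MeasurableSet E →
      |fiberSum μ q E - fiberSum μ (r n) E| < 2 * (1 / ((m : ℝ) + 1)) := by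
    intro m n hmn ι _ q hq hqp E hE
    exact fiberSum_sub_lt (hp m) (h m) hq hqp (hr n) (hrp m n hmn) hE
  have hsmall : ∀ ε : ℝ, 0 < ε → ∃ m : ℕ, 2 * (1 / ((m : ℝ) + 1)) < ε := by
    intro ε hε
    obtain ⟨m, hm⟩ := exists_nat_one_div_lt (half_pos hε)
    exact ⟨m, by linarith⟩
  have hlim : ∀ E, ∃ l : ℝ, MeasurableSet E →
      Tendsto (fun n => fiberSum μ (r n) E) atTop (𝓝 l) := by
    intro E
    by_cases hE : MeasurableSet E
    · have hc : CauchySeq fun n => fiberSum μ (r n) E := by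
        refine Metric.cauchySeq_iff'.2 fun ε hε => ?_
        obtain ⟨m, hm⟩ := hsmall ε hε
        refine ⟨m, fun n hn => ?_⟩
        rw [Real.dist_eq]
        exact (hclose m m le_rfl _ _ (hr n) (hrp m n hn) E hE).trans hm
      obtain ⟨l, hl⟩ := cauchySeq_tendsto_of_complete hc
      exact ⟨l, fun _ => hl⟩
    · exact ⟨0, fun h => (hE h).elim⟩
  choose N hN using hlim
  refine ⟨N, fun ε hε => ?_⟩
  obtain ⟨m, hm⟩ := hsmall ε hε
  refine ⟨k m, p m, hp m, fun ι _ q hq hqp E hE => ?_⟩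
  have ht : Tendsto (fun n => |fiberSum μ q E - fiberSum μ (r n) E|) atTop
      (𝓝 |fiberSum μ q E - N E|) := (tendsto_const_nhds.sub (hN E hE)).abs
  refine le_of_tendsto ht ?_
  filter_upwards [eventually_ge_atTop m] with n hn
  exact ((hclose m n hn ι q hq hqp E hE).trans hm).le

omit [MeasurableSpace T] in
theorem fiberSum_nonneg {ι : Type*} [Fintype ι] (q : T → ι) (E : Set T) : 0 ≤ fiberSum μ q E :=
  Finset.sum_nonneg fun _ _ => NNReal.coe_nonneg _

omit [MeasurableSpace T] in
theorem fiberSum_empty (hμ_empty : μ ∅ = 0) {ι : Type*} [Fintype ι] (q : T → ι) :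
    fiberSum μ q ∅ = 0 := by
  simp [fiberSum, hμ_empty]

omit [MeasurableSpace T] in
-- A fibre of `q` that meets `D` lies in `D`, so no fibre meets both sets.
theorem fiberSum_union (hμ_empty : μ ∅ = 0) {ι : Type*} [Fintype ι] (q : T → ι) {D E : Set T}
    (hDE : Disjoint D E) (hq : IndexRefines q fun x => x ∈ D) :
    fiberSum μ q (D ∪ E) = fiberSum μ q D + fiberSum μ q E := by
  unfold fiberSum
  rw [← Finset.sum_add_distrib]
  refine Finset.sum_congr rfl fun i _ => ?_
  by_cases h : ∃ x ∈ D, q x = i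
  · obtain ⟨x, hx, rfl⟩ := h
    have : q ⁻¹' {q x} ∩ E = ∅ := by
      ext y
      simp only [mem_inter_iff, mem_preimage, mem_singleton_iff, mem_empty_iff_false, iff_false,
        not_and]
      intro hy hyE
      have : y ∈ D := (hq y x hy).mpr hx
      exact Set.disjoint_left.1 hDE this hyE
    rw [inter_union_distrib_left, this]
    simp [hμ_empty]
  · have : q ⁻¹' {i} ∩ D = ∅ := by
      ext y
      simp only [mem_inter_iff, mem_preimage, mem_singleton_iff, mem_empty_iff_false, iff_false,
        not_and]
      exact fun hy hyD => h ⟨y, hyD, hy⟩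
    rw [inter_union_distrib_left, this]
    simp [hμ_empty]

namespace IsFiberLimit

variable {N : Set T → ℝ} (hN : IsFiberLimit μ N)
include hN

theorem nonneg {E : Set T} (hE : MeasurableSet E) : 0 ≤ N E := by
  refine le_of_forall_pos_le_add fun ε hε => ?_
  obtain ⟨k, p, hp, h⟩ := hN ε hε
  have := abs_le.1 (h _ p hp (fun _ _ h => h) E hE)
  linarith [fiberSum_nonneg (μ := μ) p E, this.2]

theorem empty (hμ_empty : μ ∅ = 0) : N ∅ = 0 := by
  refine le_antisymm (le_of_forall_pos_le_add fun ε hε => ?_) (hN.nonneg MeasurableSet.empty)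
  obtain ⟨k, p, hp, h⟩ := hN ε hε
  have := abs_le.1 (h _ p hp (fun _ _ h => h) ∅ MeasurableSet.empty)
  rw [fiberSum_empty hμ_empty] at this
  linarith [this.1]

theorem union (hμ_empty : μ ∅ = 0) {D E : Set T} (hD : MeasurableSet D) (hE : MeasurableSet E)
    (hDE : Disjoint D E) : N (D ∪ E) = N D + N E := by
  refine eq_of_forall_dist_le fun ε hε => ?_
  obtain ⟨k, p, hp, h⟩ := hN (ε / 3) (by positivity)
  have hmD : HasMeasurableFibers fun x => x ∈ D := by
    intro P
    by_cases hP : P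
    · convert hD using 1
      ext x; simp [hP]
    · convert hD.compl using 1
      ext x; simp [hP]
  have hq := hp.prodMk hmD
  have h' := h _ _ hq (IndexRefines.fst _ _)
  have h1 := abs_le.1 (h' D hD)
  have h2 := abs_le.1 (h' E hE)
  have h3 := abs_le.1 (h' _ (hD.union hE))
  rw [fiberSum_union hμ_empty _ hDE (IndexRefines.snd _ _)] at h3
  rw [Real.dist_eq, abs_le]
  constructor <;> linarith [h1.1, h1.2, h2.1, h2.2, h3.1, h3.2]

/-- A single finite partition approximates `N` on all measurable sets at once, and a finite sum of
traces of `μ` is continuous from below. -/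
theorem tendsto (hμ_cont : IsContinuousFromBelow μ) {B : ℕ → Set T}
    (hB : ∀ n, MeasurableSet (B n)) (hmono : Monotone B) :
    Tendsto (fun n => N (B n)) atTop (𝓝 (N (⋃ n, B n))) := by
  refine Metric.tendsto_atTop'.2 fun ε hε => ?_
  obtain ⟨k, p, hp, h⟩ := hN (ε / 3) (by positivity)
  have hU : MeasurableSet (⋃ n, B n) := MeasurableSet.iUnion hB
  have ht : Tendsto (fun n => fiberSum μ p (B n)) atTop (𝓝 (fiberSum μ p (⋃ n, B n))) := by
    refine tendsto_finsetSum _ fun i _ => NNReal.tendsto_coe.2 ?_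
    rw [inter_iUnion]
    exact hμ_cont _ (fun n => (hp i).inter (hB n)) fun m n hmn =>
      inter_subset_inter_right _ (hmono hmn)
  obtain ⟨n₀, hn₀⟩ := Metric.tendsto_atTop'.1 ht (ε / 3) (by positivity)
  refine ⟨n₀, fun n hn => ?_⟩
  have h0 := hn₀ n hn
  rw [Real.dist_eq, abs_lt] at h0 ⊢
  have h' := h _ p hp (fun _ _ h => h)
  have h1 := abs_le.1 (h' _ (hB n))
  have h2 := abs_le.1 (h' _ hU)
  constructor <;> linarith [h0.1, h0.2, h1.1, h1.2, h2.1, h2.2]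

theorem biUnion (hμ_empty : μ ∅ = 0) {f : ℕ → Set T} (hf : ∀ n, MeasurableSet (f n))
    (hd : Pairwise (Function.onFun Disjoint f)) (n : ℕ) :
    N (⋃ i ∈ Finset.range n, f i) = ∑ i ∈ Finset.range n, N (f i) := by
  induction n with
  | zero => simpa using hN.empty hμ_empty
  | succ n ih =>
    rw [Finset.range_add_one, Finset.set_biUnion_insert, hN.union hμ_empty (hf n)
      (Finset.measurableSet_biUnion _ fun i _ => hf i), ih, Finset.sum_insert (by simp)]
    rw [disjoint_iUnion₂_right]
    intro i hi
    exact hd (Finset.mem_range.1 hi).ne'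

/-- Finite additivity together with continuity along increasing partial unions gives countable
additivity. -/
theorem exists_measure (hμ_empty : μ ∅ = 0) (hμ_cont : IsContinuousFromBelow μ) :
    ∃ ν : MeasureTheory.Measure T, MeasureTheory.IsFiniteMeasure ν ∧
      ∀ E, MeasurableSet E → ν.real E = N E := by
  let ν : MeasureTheory.Measure T := MeasureTheory.Measure.ofMeasurable
    (fun E _ => ENNReal.ofReal (N E)) (by simp [hN.empty hμ_empty]) (by
      intro f hf hd
      refine tendsto_nhds_unique ?_ (ENNReal.tendsto_nat_tsum _)
      have hU : ⋃ n, ⋃ i ∈ Finset.range n, f i = ⋃ i, f i := by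
        ext x
        simp only [mem_iUnion, Finset.mem_range]
        exact ⟨fun ⟨_, i, _, hi⟩ => ⟨i, hi⟩, fun ⟨i, hi⟩ => ⟨i + 1, i, Nat.lt_succ_self i, hi⟩⟩
      have := hN.tendsto hμ_cont (B := fun n => ⋃ i ∈ Finset.range n, f i)
        (fun n => Finset.measurableSet_biUnion _ fun i _ => hf i)
        (fun m n hmn => biUnion_subset_biUnion_left
          fun i hi => Finset.range_mono hmn hi)
      rw [hU] at this
      simp only [hN.biUnion hμ_empty hf hd] at this
      refine (ENNReal.tendsto_ofReal this).congr fun n => ?_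
      exact ENNReal.ofReal_sum_of_nonneg fun i _ => hN.nonneg (hf i))
  have hν : ∀ E, MeasurableSet E → ν E = ENNReal.ofReal (N E) := fun E hE =>
    MeasureTheory.Measure.ofMeasurable_apply E hE
  refine ⟨ν, ⟨?_⟩, fun E hE => ?_⟩
  · rw [hν _ MeasurableSet.univ]
    exact ENNReal.ofReal_lt_top
  · rw [MeasureTheory.measureReal_def, hν E hE, ENNReal.toReal_ofReal (hN.nonneg hE)]

end IsFiberLimit

/-- On all fine enough partitions, the total variation of `μ - ν` is small. -/
def IsApproximatedBy (μ : Set T → ℝ≥0) (ν : MeasureTheory.Measure T) : Prop :=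
  ∀ ε : ℝ, 0 < ε → ∃ (k : ℕ) (p : T → Fin k), HasMeasurableFibers p ∧
    ∀ (ι : Type) (q : T → ι), HasMeasurableFibers q → IndexRefines q p →
      ∀ S : Finset ι, ∑ i ∈ S, |(μ (q ⁻¹' {i}) : ℝ) - ν.real (q ⁻¹' {i})| ≤ ε

/-- An integrable set function that is continuous from below is close, on all fine enough
partitions, to a finite measure. -/
theorem exists_isApproximatedBy (hμ_empty : μ ∅ = 0) (hμ : IsIntegrableSetFunction μ)
    (hμ_cont : IsContinuousFromBelow μ) :
    ∃ ν : MeasureTheory.Measure T, MeasureTheory.IsFiniteMeasure ν ∧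
      IsApproximatedBy μ ν := by
  classical
  obtain ⟨N, hN⟩ := exists_isFiberLimit hμ_empty hμ
  obtain ⟨ν, hν, hνN⟩ := hN.exists_measure hμ_empty hμ_cont
  refine ⟨ν, hν, fun ε hε => ?_⟩
  obtain ⟨k, p, hp, h⟩ := hN (ε / 2) (by positivity)
  refine ⟨k, p, hp, fun ι q hq hqp S => ?_⟩
  -- Only finitely many fibres of `q` are involved: keep those in `S`, use `p` elsewhere, and apply
  -- the uniform estimate of `hN` to their union.
  have key : ∀ S : Finset ι,
      |∑ i ∈ S, ((μ (q ⁻¹' {i}) : ℝ) - ν.real (q ⁻¹' {i}))| ≤ ε / 2 := by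
    intro S
    let r : T → S ⊕ Fin k := fun x => if hx : q x ∈ S then Sum.inl ⟨q x, hx⟩ else Sum.inr (p x)
    have hE : MeasurableSet (⋃ i ∈ S, q ⁻¹' {i}) :=
      Finset.measurableSet_biUnion _ fun i _ => hq i
    have hl : ∀ i : S, r ⁻¹' {Sum.inl i} = q ⁻¹' {(i : ι)} := by
      rintro ⟨i, hi⟩
      ext x
      by_cases hx : q x ∈ S
      · simp [r, hx]
      · simp only [mem_preimage, hx, ↓reduceDIte, mem_singleton_iff, reduceCtorEq, false_iff, r]
        rintro rfl
        exact hx hi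
    have hrr : ∀ j, r ⁻¹' {Sum.inr j} = p ⁻¹' {j} ∩ (⋃ i ∈ S, q ⁻¹' {i})ᶜ := by
      intro j
      ext x
      by_cases hx : q x ∈ S <;> simp [r, hx]
    have hr : HasMeasurableFibers r := by
      rintro (i | j)
      · rw [hl]; exact hq _
      · rw [hrr]; exact (hp j).inter hE.compl
    have hrp : IndexRefines r p := by
      intro x y hxy
      by_cases hx : q x ∈ S <;> by_cases hy : q y ∈ S <;> simp [r, hx, hy] at hxy
      · exact hqp x y hxy
      · exact hxy
    have hsum : fiberSum μ r (⋃ i ∈ S, q ⁻¹' {i}) = ∑ i ∈ S, (μ (q ⁻¹' {i}) : ℝ) := by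
      rw [fiberSum, Fintype.sum_sum_type, ← Finset.sum_coe_sort S]
      have h0 : ∀ j, r ⁻¹' {Sum.inr j} ∩ (⋃ i ∈ S, q ⁻¹' {i}) = ∅ := fun j => by
        rw [hrr, inter_assoc, compl_inter_self, inter_empty]
      have h1 : ∀ i : S, r ⁻¹' {Sum.inl i} ∩ (⋃ i ∈ S, q ⁻¹' {i}) = q ⁻¹' {(i : ι)} := fun i => by
        rw [hl]
        exact inter_eq_left.2 (subset_biUnion_of_mem (u := fun i => q ⁻¹' {i}) i.2)
      simp only [h0, h1, hμ_empty, NNReal.coe_zero, Finset.sum_const_zero, add_zero]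
    have hνsum : ν.real (⋃ i ∈ S, q ⁻¹' {i}) = ∑ i ∈ S, ν.real (q ⁻¹' {i}) := by
      refine MeasureTheory.measureReal_biUnion_finset ?_ fun i _ => hq i
      intro i _ j _ hij
      refine Set.disjoint_left.2 ?_
      rintro x rfl hx
      exact hij hx
    have := h _ r hr hrp _ hE
    rwa [hsum, ← hνN _ hE, hνsum, ← Finset.sum_sub_distrib] at this
  -- Splitting `S` by the sign of the difference turns two signed bounds `ε / 2` into the bound `ε`
  -- for the sum of absolute values.
  rw [← Finset.sum_filter_add_sum_filter_not S
    (fun i => 0 ≤ (μ (q ⁻¹' {i}) : ℝ) - ν.real (q ⁻¹' {i}))]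
  have h1 := key (S.filter fun i => 0 ≤ (μ (q ⁻¹' {i}) : ℝ) - ν.real (q ⁻¹' {i}))
  have h2 := key (S.filter fun i => ¬ 0 ≤ (μ (q ⁻¹' {i}) : ℝ) - ν.real (q ⁻¹' {i}))
  rw [Finset.sum_congr rfl fun i hi => abs_of_nonneg (Finset.mem_filter.1 hi).2,
    Finset.sum_congr rfl fun i hi => abs_of_neg (not_le.1 (Finset.mem_filter.1 hi).2),
    Finset.sum_neg_distrib]
  linarith [(abs_le.1 h1).2, (abs_le.1 h2).1]

end LimitMeasure

/-! ### Convex weakly compact sets, support functions and the Hausdorff distance. -/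

section ConvexWeaklyCompact

variable {X : Type*} [NormedAddCommGroup X] [NormedSpace ℝ X]

theorem isClosed_of_mem_cwkSets {A : Set X} (hA : A ∈ cwkSets X) : IsClosed A := by
  have h : IsClosed (toWeakSpaceCLM ℝ X ⁻¹' (toWeakSpace ℝ X '' A)) :=
    hA.2.2.isClosed.preimage (toWeakSpaceCLM ℝ X).continuous
  have h2 : toWeakSpaceCLM ℝ X ⁻¹' (toWeakSpace ℝ X '' A) = A :=
    preimage_image_eq A (toWeakSpace ℝ X).injective
  rwa [h2] at h

theorem isBounded_of_mem_cwkSets {A : Set X} (hA : A ∈ cwkSets X) : Bornology.IsBounded A := by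
  obtain ⟨M, hM⟩ := exists_bound_of_mem_cwkSets hA
  exact isBounded_iff_forall_norm_le.2 ⟨M, hM⟩

theorem zero_mem_cwkSets : (0 : Set X) ∈ cwkSets X :=
  ⟨⟨0, rfl⟩, convex_singleton 0, by
    rw [← singleton_zero, image_singleton]; exact isCompact_singleton⟩

theorem add_mem_cwkSets {A B : Set X} (hA : A ∈ cwkSets X) (hB : B ∈ cwkSets X) :
    A + B ∈ cwkSets X := by
  refine ⟨hA.1.add hB.1, hA.2.1.add hB.2.1, ?_⟩
  rw [image_add]
  exact hA.2.2.add hB.2.2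

theorem smul_mem_cwkSets (c : ℝ) {A : Set X} (hA : A ∈ cwkSets X) : c • A ∈ cwkSets X := by
  refine ⟨hA.1.smul_set, hA.2.1.smul c, ?_⟩
  rw [image_smul_set]
  exact hA.2.2.smul c

theorem sum_mem_cwkSets {ι : Type*} (s : Finset ι) {A : ι → Set X} (hA : ∀ i, A i ∈ cwkSets X) :
    ∑ i ∈ s, A i ∈ cwkSets X := by
  classical
  induction s using Finset.induction_on with
  | empty => simpa using zero_mem_cwkSets
  | insert i s hi ih => rw [Finset.sum_insert hi]; exact add_mem_cwkSets (hA i) ih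

/-- A Minkowski sum of weakly compact sets is weakly compact, hence norm closed. -/
theorem closedSum_eq {ι : Type*} (s : Finset ι) {A : ι → Set X} (hA : ∀ i, A i ∈ cwkSets X) :
    closedSum s A = ∑ i ∈ s, A i :=
  (isClosed_of_mem_cwkSets (sum_mem_cwkSets s hA)).closure_eq

/-- The supremum of the functional `φ` on `A`. -/
def supOn (A : Set X) (φ : StrongDual ℝ X) : ℝ := sSup (φ '' A)

theorem bddAbove_image {A : Set X} (hA : A ∈ cwkSets X) (φ : StrongDual ℝ X) :
    BddAbove (φ '' A) :=
  (φ.lipschitz.isBounded_image (isBounded_of_mem_cwkSets hA)).bddAbove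

theorem supOn_zero (φ : StrongDual ℝ X) : supOn (0 : Set X) φ = 0 := by
  simp [supOn, ← singleton_zero]

theorem supOn_add {A B : Set X} (hA : A ∈ cwkSets X) (hB : B ∈ cwkSets X)
    (φ : StrongDual ℝ X) : supOn (A + B) φ = supOn A φ + supOn B φ := by
  rw [supOn, image_add]
  exact csSup_add (hA.1.image _) (bddAbove_image hA φ) (hB.1.image _) (bddAbove_image hB φ)

theorem supOn_smul {c : ℝ} (hc : 0 ≤ c) (A : Set X) (φ : StrongDual ℝ X) :
    supOn (c • A) φ = c * supOn A φ := by
  rw [supOn, image_smul_set, Real.sSup_smul_of_nonneg hc]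
  rfl

theorem supOn_sum {ι : Type*} (s : Finset ι) {A : ι → Set X} (hA : ∀ i, A i ∈ cwkSets X)
    (φ : StrongDual ℝ X) : supOn (∑ i ∈ s, A i) φ = ∑ i ∈ s, supOn (A i) φ := by
  classical
  induction s using Finset.induction_on with
  | empty => simpa using supOn_zero φ
  | insert i s hi ih =>
    rw [Finset.sum_insert hi, Finset.sum_insert hi, supOn_add (hA i) (sum_mem_cwkSets s hA), ih]

theorem supOn_le_of_hausdorffEDist_le {A B : Set X} (hA : A ∈ cwkSets X) (hB : B ∈ cwkSets X)
    {r : ℝ} (hr : 0 ≤ r) (h : Metric.hausdorffEDist A B ≤ ENNReal.ofReal r)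
    {φ : StrongDual ℝ X} (hφ : ‖φ‖ ≤ 1) : supOn A φ ≤ supOn B φ + r := by
  refine le_of_forall_pos_le_add fun δ hδ => csSup_le (hA.1.image _) ?_
  rintro _ ⟨x, hx, rfl⟩
  have hlt : Metric.hausdorffEDist A B < ENNReal.ofReal (r + δ) :=
    h.trans_lt ((ENNReal.ofReal_lt_ofReal_iff (by positivity)).2 (by linarith))
  obtain ⟨y, hy, hxy⟩ := Metric.exists_edist_lt_of_hausdorffEDist_lt hx hlt
  rw [edist_dist, ENNReal.ofReal_lt_ofReal_iff (by positivity), dist_eq_norm] at hxy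
  have h1 : φ x - φ y ≤ ‖x - y‖ := by
    rw [← map_sub]
    exact (le_abs_self _).trans (by simpa using φ.le_of_opNorm_le hφ (x - y))
  have h2 : φ y ≤ supOn B φ := le_csSup (bddAbove_image hB φ) (mem_image_of_mem _ hy)
  linarith

theorem abs_supOn_sub_le_of_hausdorffEDist_le {A B : Set X} (hA : A ∈ cwkSets X)
    (hB : B ∈ cwkSets X) {r : ℝ} (hr : 0 ≤ r)
    (h : Metric.hausdorffEDist A B ≤ ENNReal.ofReal r)
    {φ : StrongDual ℝ X} (hφ : ‖φ‖ ≤ 1) : |supOn A φ - supOn B φ| ≤ r := by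
  have h1 := supOn_le_of_hausdorffEDist_le hA hB hr h hφ
  have h2 := supOn_le_of_hausdorffEDist_le hB hA hr (Metric.hausdorffEDist_comm.trans_le h) hφ
  rw [abs_le]
  constructor <;> linarith

/-- If `x` were farther than `r` from `B`, some open thickening of the convex set `B` of radius `ρ >
r` would miss `x`. A separating `φ` satisfies `supOn B φ + ρ * ‖φ‖ ≤ φ x`, and normalising it
contradicts the hypothesis. -/
theorem infEDist_le_of_forall_supOn_le {A B : Set X} (hA : A ∈ cwkSets X) (hB : B ∈ cwkSets X)
    {r : ℝ} (hr : 0 ≤ r) (h : ∀ φ : StrongDual ℝ X, ‖φ‖ ≤ 1 → supOn A φ ≤ supOn B φ + r)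
    {x : X} (hx : x ∈ A) : Metric.infEDist x B ≤ ENNReal.ofReal r := by
  by_contra! hlt
  obtain ⟨ρ, hρ, hrρ, hρx⟩ : ∃ ρ : ℝ, 0 < ρ ∧ r < ρ ∧ x ∉ Metric.thickening ρ B := by
    obtain ⟨c, hrc, hcx⟩ := ENNReal.lt_iff_exists_nnreal_btwn.1 hlt
    have hrc' : r < c := by
      rwa [← ENNReal.ofReal_coe_nnreal, ENNReal.ofReal_lt_ofReal_iff_of_nonneg hr] at hrc
    refine ⟨c, hr.trans_lt hrc', hrc', fun hmem => ?_⟩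
    rw [Metric.mem_thickening_iff_infEDist_lt, ENNReal.ofReal_coe_nnreal] at hmem
    exact hmem.not_gt hcx
  obtain ⟨φ, hφ⟩ := geometric_hahn_banach_open_point (hB.2.1.thickening ρ)
    Metric.isOpen_thickening hρx
  obtain ⟨y₀, hy₀⟩ := hB.1
  have hφ0 : φ ≠ 0 := by
    rintro rfl
    simpa using hφ y₀ (Metric.self_subset_thickening hρ B hy₀)
  have hn : 0 < ‖φ‖ := norm_pos_iff.2 hφ0
  have hball : ∀ y ∈ B, φ y + ρ * ‖φ‖ ≤ φ x := by
    intro y hy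
    have hu : ∀ u : X, ‖u‖ < ρ → φ u < φ x - φ y := by
      intro u hu
      have := hφ (y + u) (Metric.mem_thickening_iff.2 ⟨y, hy, by simpa using hu⟩)
      rw [map_add] at this
      linarith
    -- A vector `v` of norm less than one nearly attains `‖φ‖` in absolute value; both `ρ • v` and
    -- `-ρ • v` are tested because the sign of `φ v` is unknown.
    by_contra! hcon
    have hlt' : (φ x - φ y) / ρ < ‖φ‖ := by
      rw [div_lt_iff₀ hρ]
      linarith
    obtain ⟨v, hv, hvφ⟩ := φ.exists_lt_apply_of_lt_opNorm hlt'
    have hnorm : ∀ c : ℝ, |c| = ρ → ‖c • v‖ < ρ := by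
      intro c hc
      rw [norm_smul, Real.norm_eq_abs, hc]
      nlinarith
    have h1 := hu (ρ • v) (hnorm ρ (abs_of_pos hρ))
    have h2 := hu ((-ρ) • v) (hnorm (-ρ) (by rw [abs_neg, abs_of_pos hρ]))
    rw [map_smul, smul_eq_mul] at h1 h2
    rw [div_lt_iff₀ hρ, Real.norm_eq_abs] at hvφ
    rcases abs_cases (φ v) with ⟨h, -⟩ | ⟨h, -⟩ <;> rw [h] at hvφ <;> linarith
  have hxs : φ x ≤ supOn A φ := le_csSup (bddAbove_image hA φ) (mem_image_of_mem _ hx)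
  have hs : supOn B φ + ρ * ‖φ‖ ≤ φ x := by
    have : supOn B φ ≤ φ x - ρ * ‖φ‖ := by
      refine csSup_le ⟨_, mem_image_of_mem _ hy₀⟩ ?_
      rintro _ ⟨y, hy, rfl⟩
      linarith [hball y hy]
    linarith
  have hscale : ∀ C : Set X, supOn C (‖φ‖⁻¹ • φ) = ‖φ‖⁻¹ * supOn C φ := by
    intro C
    have : (‖φ‖⁻¹ • φ) '' C = ‖φ‖⁻¹ • (φ '' C) := by
      ext z; simp [mem_smul_set]
    rw [supOn, this, Real.sSup_smul_of_nonneg (by positivity)]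
    rfl
  have := h (‖φ‖⁻¹ • φ) (by rw [norm_smul, norm_inv, norm_norm, inv_mul_cancel₀ hn.ne'])
  rw [hscale, hscale] at this
  have h3 : ‖φ‖⁻¹ * supOn A φ ≥ ‖φ‖⁻¹ * (supOn B φ + ρ * ‖φ‖) :=
    mul_le_mul_of_nonneg_left (hs.trans hxs) (by positivity)
  rw [mul_add, mul_comm ρ, ← mul_assoc, inv_mul_cancel₀ hn.ne', one_mul] at h3
  linarith

theorem hausdorffEDist_le_of_forall_abs_supOn_sub_le {A B : Set X} (hA : A ∈ cwkSets X)
    (hB : B ∈ cwkSets X) {r : ℝ} (hr : 0 ≤ r)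
    (h : ∀ φ : StrongDual ℝ X, ‖φ‖ ≤ 1 → |supOn A φ - supOn B φ| ≤ r) :
    Metric.hausdorffEDist A B ≤ ENNReal.ofReal r := by
  refine Metric.hausdorffEDist_le_of_infEDist (fun x hx => ?_) fun x hx => ?_
  · exact infEDist_le_of_forall_supOn_le hA hB hr
      (fun φ hφ => by linarith [(abs_le.1 (h φ hφ)).2]) hx
  · exact infEDist_le_of_forall_supOn_le hB hA hr
      (fun φ hφ => by linarith [(abs_le.1 (h φ hφ)).1]) hx

omit [NormedSpace ℝ X] in
theorem mem_closure_of_hausdorffEDist_lt {I : Set X} {x : X}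
    (h : ∀ ε : ℝ, 0 < ε → ∃ y : X, dist x y < ε ∧
      ∃ K : Set X, y ∈ K ∧ Metric.hausdorffEDist K I < ENNReal.ofReal ε) : x ∈ closure I := by
  refine Metric.mem_closure_iff.2 fun ε hε => ?_
  obtain ⟨y, hxy, K, hyK, hK⟩ := h (ε / 2) (by positivity)
  obtain ⟨z, hz, hyz⟩ := Metric.exists_edist_lt_of_hausdorffEDist_lt hyK hK
  rw [edist_dist, ENNReal.ofReal_lt_ofReal_iff (by positivity)] at hyz
  exact ⟨z, hz, by linarith [dist_triangle x y z]⟩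

theorem convex_of_hausdorffEDist_lt {I : Set X} (hI : IsClosed I)
    (h : ∀ ε : ℝ, 0 < ε → ∃ K : Set X, Convex ℝ K ∧
      Metric.hausdorffEDist K I < ENNReal.ofReal ε) : Convex ℝ I := by
  intro x hx y hy a b ha hb hab
  rw [← hI.closure_eq]
  refine mem_closure_of_hausdorffEDist_lt fun ε hε => ?_
  obtain ⟨K, hK, hKI⟩ := h ε hε
  have hIK := Metric.hausdorffEDist_comm.trans_lt hKI
  obtain ⟨x', hx', hxx'⟩ := Metric.exists_edist_lt_of_hausdorffEDist_lt hx hIK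
  obtain ⟨y', hy', hyy'⟩ := Metric.exists_edist_lt_of_hausdorffEDist_lt hy hIK
  rw [edist_dist, ENNReal.ofReal_lt_ofReal_iff hε, dist_eq_norm] at hxx' hyy'
  refine ⟨a • x' + b • y', ?_, K, hK hx' hy' ha hb hab, hKI⟩
  have : a • x + b • y - (a • x' + b • y') = a • (x - x') + b • (y - y') := by
    rw [smul_sub, smul_sub]; abel
  rw [dist_eq_norm, this]
  have := convex_ball (0 : X) ε (mem_ball_zero_iff.2 hxx') (mem_ball_zero_iff.2 hyy') ha hb hab
  exact mem_ball_zero_iff.1 this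

theorem tendsto_toWeakSpace_iff {α : Type*} {l : Filter α} {f : α → X} {x : X} :
    Tendsto (fun a => toWeakSpace ℝ X (f a)) l (𝓝 (toWeakSpace ℝ X x)) ↔
      ∀ φ : StrongDual ℝ X, Tendsto (fun a => φ (f a)) l (𝓝 (φ x)) := by
  refine (WeakBilin.tendsto_iff_forall_eval_tendsto (topDualPairing ℝ X).flip ?_)
  intro x y hxy
  exact (SeparatingDual.eq_iff_forall_dual_eq (R := ℝ)).2 fun φ => congrArg (fun g => g φ) hxy

variable [CompleteSpace X]

/-- `cwk(X)` is closed in the hyperspace of closed sets with the Hausdorff distance. -/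
theorem mem_cwkSets_of_hausdorffEDist_lt {I : Set X} (hI : IsClosed I)
    (h : ∀ ε : ℝ, 0 < ε → ∃ K ∈ cwkSets X, Metric.hausdorffEDist K I < ENNReal.ofReal ε) :
    I ∈ cwkSets X := by
  refine ⟨?_, convex_of_hausdorffEDist_lt hI fun ε hε => ?_, ?_⟩
  · obtain ⟨K, hK, hKI⟩ := h 1 one_pos
    exact Metric.nonempty_of_hausdorffEDist_ne_top hK.1 hKI.ne_top
  · obtain ⟨K, hK, hKI⟩ := h ε hε
    exact ⟨K, hK.2.1, hKI⟩
  -- Move the points of an ultrafilter on `I` to nearby points of each `K n`, where weak compactness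
  -- gives a weak limit `k n`. The `k n` form a norm Cauchy sequence, and the ultrafilter converges
  -- weakly to its limit.
  · choose K hK hKI using fun n : ℕ => h (1 / ((n : ℝ) + 1)) (by positivity)
    rw [isCompact_iff_ultrafilter_le_nhds]
    intro U hU
    have hUI : ∀ᶠ y in (U : Filter (WeakSpace ℝ X)), (toWeakSpace ℝ X).symm y ∈ I := by
      filter_upwards [le_principal_iff.1 hU]
      rintro _ ⟨x, hx, rfl⟩
      simpa using hx
    have hp : ∀ n (y : WeakSpace ℝ X), ∃ z ∈ K n, (toWeakSpace ℝ X).symm y ∈ I →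
        ‖(toWeakSpace ℝ X).symm y - z‖ < 1 / ((n : ℝ) + 1) := by
      intro n y
      by_cases hy : (toWeakSpace ℝ X).symm y ∈ I
      · obtain ⟨z, hz, hyz⟩ := Metric.exists_edist_lt_of_hausdorffEDist_lt hy
          (Metric.hausdorffEDist_comm.trans_lt (hKI n))
        rw [edist_dist, ENNReal.ofReal_lt_ofReal_iff (by positivity), dist_eq_norm] at hyz
        exact ⟨z, hz, fun _ => hyz⟩
      · obtain ⟨z, hz⟩ := (hK n).1
        exact ⟨z, hz, fun h => (hy h).elim⟩
    choose p hpK hp using hp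
    have hk : ∀ n, ∃ k ∈ K n, ∀ φ : StrongDual ℝ X,
        Tendsto (fun y => φ (p n y)) U (𝓝 (φ k)) := by
      intro n
      obtain ⟨_, ⟨k, hk, rfl⟩, hUk⟩ := isCompact_iff_ultrafilter_le_nhds.1 (hK n).2.2
        (U.map fun y => toWeakSpace ℝ X (p n y))
        (le_principal_iff.2 (mem_map.2 (univ_mem' fun y => mem_image_of_mem _ (hpK n y))))
      exact ⟨k, hk, tendsto_toWeakSpace_iff.1 hUk⟩
    choose k hkK hk using hk
    -- This is weak lower semicontinuity of the norm, tested on functionals: the points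
    -- approximating the same `y` differ by at most the stated amount.
    have hdist : ∀ m n, ‖k m - k n‖ ≤ 1 / ((m : ℝ) + 1) + 1 / ((n : ℝ) + 1) := by
      intro m n
      refine NormedSpace.norm_le_dual_bound ℝ _ (by positivity) fun φ => ?_
      rw [map_sub]
      refine le_of_tendsto ((hk m φ).sub (hk n φ)).norm ?_
      filter_upwards [hUI] with y hy
      rw [← map_sub, mul_comm]
      refine (φ.le_opNorm _).trans (mul_le_mul_of_nonneg_left ?_ (norm_nonneg _))
      have h1 := hp m y hy
      have h2 := hp n y hy
      calc ‖p m y - p n y‖ = ‖((toWeakSpace ℝ X).symm y - p n y)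
            - ((toWeakSpace ℝ X).symm y - p m y)‖ := by congr 1; abel
        _ ≤ _ := norm_sub_le _ _
        _ ≤ _ := by linarith
    have hc : CauchySeq k := by
      refine Metric.cauchySeq_iff'.2 fun ε hε => ?_
      obtain ⟨n, hn⟩ := exists_nat_one_div_lt (half_pos hε)
      refine ⟨n, fun m hm => ?_⟩
      rw [dist_eq_norm]
      have : 1 / ((m : ℝ) + 1) ≤ 1 / ((n : ℝ) + 1) := Nat.one_div_le_one_div hm
      linarith [hdist m n]
    obtain ⟨x, hx⟩ := cauchySeq_tendsto_of_complete hc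
    have hclose : ∀ ε : ℝ, 0 < ε → ∃ n : ℕ, 1 / ((n : ℝ) + 1) < ε ∧ dist x (k n) < ε := by
      intro ε hε
      have h1 := tendsto_one_div_add_atTop_nhds_zero_nat (𝕜 := ℝ) |>.eventually (gt_mem_nhds hε)
      have h2 := Metric.tendsto_nhds.1 hx ε hε
      obtain ⟨n, hn1, hn2⟩ := (h1.and h2).exists
      exact ⟨n, hn1, by rwa [dist_comm]⟩
    refine ⟨toWeakSpace ℝ X x, mem_image_of_mem _ ?_, ?_⟩
    · rw [← hI.closure_eq]
      refine mem_closure_of_hausdorffEDist_lt fun ε hε => ?_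
      obtain ⟨n, hn, hxn⟩ := hclose ε hε
      exact ⟨k n, hxn, K n, hkK n, (hKI n).trans
        ((ENNReal.ofReal_lt_ofReal_iff hε).2 hn)⟩
    · have : Tendsto (fun y => toWeakSpace ℝ X ((toWeakSpace ℝ X).symm y)) U
          (𝓝 (toWeakSpace ℝ X x)) := by
        refine tendsto_toWeakSpace_iff.2 fun φ => Metric.tendsto_nhds.2 fun ε hε => ?_
        have hδ : 0 < ε / (3 * (‖φ‖ + 1)) := by positivity
        obtain ⟨n, hn, hxn⟩ := hclose _ hδ
        have hb : ∀ v : X, ‖v‖ < ε / (3 * (‖φ‖ + 1)) → |φ v| < ε / 3 := by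
          intro v hv
          have h1 : |φ v| ≤ ‖φ‖ * ‖v‖ := φ.le_opNorm v
          rw [lt_div_iff₀ (by positivity)] at hv
          nlinarith [norm_nonneg v, norm_nonneg φ]
        filter_upwards [hUI, Metric.tendsto_nhds.1 (hk n φ) (ε / 3) (by positivity)] with y hy hyn
        have h1 := hb _ ((hp n y hy).trans hn)
        rw [dist_comm, dist_eq_norm] at hxn
        have h2 := hb _ hxn
        rw [map_sub] at h1 h2
        rw [Real.dist_eq] at hyn ⊢
        rw [abs_lt] at *
        constructor <;> linarith [h1.1, h1.2, h2.1, h2.2, hyn.1, hyn.2]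
      simpa [Tendsto] using this

/-- The closed sets with the Hausdorff distance form a complete space, in which `cwkSets X` is
closed. -/
theorem exists_limit_mem_cwkSets {K : ℕ → Set X} (hK : ∀ n, K n ∈ cwkSets X) {e : ℕ → ℝ}
    (he : Tendsto e atTop (𝓝 0))
    (h : ∀ m n, Metric.hausdorffEDist (K m) (K n) ≤ ENNReal.ofReal (e m + e n)) :
    ∃ I ∈ cwkSets X, ∀ n, Metric.hausdorffEDist (K n) I ≤ ENNReal.ofReal (e n) := by
  let C : ℕ → TopologicalSpace.Closeds X := fun n => ⟨K n, isClosed_of_mem_cwkSets (hK n)⟩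
  have hC : CauchySeq C := by
    refine EMetric.cauchySeq_iff.2 fun ε hε => ?_
    have ht : Tendsto (fun p : ℕ × ℕ => ENNReal.ofReal (e p.1 + e p.2)) atTop (𝓝 0) := by
      have h1 : Tendsto (fun p : ℕ × ℕ => e p.1 + e p.2) atTop (𝓝 (0 + 0)) := by
        rw [← prod_atTop_atTop_eq]
        exact (he.comp tendsto_fst).add (he.comp tendsto_snd)
      simpa using ENNReal.tendsto_ofReal h1
    obtain ⟨⟨a, b⟩, hab⟩ := eventually_atTop.1 (ht.eventually (gt_mem_nhds hε))
    refine ⟨max a b, fun m hm n hn => ?_⟩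
    exact (h m n).trans_lt (hab (m, n) ⟨(le_max_left _ _).trans hm, (le_max_right _ _).trans hn⟩)
  obtain ⟨I, hI⟩ := cauchySeq_tendsto_of_complete hC
  have hle : ∀ n, Metric.hausdorffEDist (K n) I ≤ ENNReal.ofReal (e n) := by
    intro n
    have h1 : Tendsto (fun m => edist (C n) (C m)) atTop (𝓝 (edist (C n) I)) :=
      tendsto_const_nhds.edist hI
    have h2 : Tendsto (fun m => ENNReal.ofReal (e n + e m)) atTop (𝓝 (ENNReal.ofReal (e n))) := by
      have := ENNReal.tendsto_ofReal (he.const_add (e n))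
      rwa [add_zero] at this
    exact le_of_tendsto_of_tendsto' h1 h2 fun m => h n m
  refine ⟨I, mem_cwkSets_of_hausdorffEDist_lt I.isClosed fun ε hε => ?_, hle⟩
  obtain ⟨n, hn⟩ := (he.eventually (gt_mem_nhds hε)).exists
  exact ⟨K n, hK n, (hle n).trans_lt ((ENNReal.ofReal_lt_ofReal_iff hε).2 hn)⟩

end ConvexWeaklyCompact

/-! ### Sums over partitions, and weighted oscillation. -/

section Oscillation

open MeasureTheory

variable {T : Type*} [MeasurableSpace T]

theorem HasMeasurableFibers.comp_injective {ι κ : Type*} {q : T → ι} (hq : HasMeasurableFibers q)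
    {e : ι → κ} (he : Function.Injective e) : HasMeasurableFibers (e ∘ q) := by
  intro j
  rw [preimage_comp]
  by_cases hj : ∃ i, e i = j
  · obtain ⟨i, rfl⟩ := hj
    rw [← image_singleton, preimage_image_eq _ he]
    exact hq i
  · rw [preimage_singleton_eq_empty.2 (by simpa using hj), preimage_empty]
    exact MeasurableSet.empty

theorem HasMeasurableFibers.integrable {κ : Type*} [Countable κ] {ν : Measure T}
    [IsFiniteMeasure ν] {a : T → κ} (ha : HasMeasurableFibers a) {h : κ → ℝ} {M : ℝ}
    (hM : ∀ i, |h i| ≤ M) : Integrable (fun x => h (a x)) ν := by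
  have hm : Measurable fun x => h (a x) := fun s _ => ha.measurableSet_preimage (h ⁻¹' s)
  exact Integrable.of_bound hm.aestronglyMeasurable M (ae_of_all _ fun x => hM _)

/-- Sums against `ν` are integrals of step functions, so sums over different partitions can be
compared pointwise. -/
theorem HasMeasurableFibers.hasSum_integral {κ : Type*} [Countable κ] {ν : Measure T}
    [IsFiniteMeasure ν] {a : T → κ} (ha : HasMeasurableFibers a) {h : κ → ℝ} {M : ℝ}
    (hM : ∀ i, |h i| ≤ M) :
    HasSum (fun i => ν.real (a ⁻¹' {i}) * h i) (∫ x, h (a x) ∂ν) := by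
  have hd : Pairwise (Function.onFun Disjoint fun i => a ⁻¹' {i}) := by
    intro i j hij
    refine Set.disjoint_left.2 ?_
    rintro x rfl hx
    exact hij hx
  have hU : ⋃ i, a ⁻¹' {i} = univ := by ext x; simp
  have := hasSum_integral_iUnion (μ := ν) (f := fun x => h (a x)) ha hd
    (ha.integrable hM).integrableOn
  rw [hU, Measure.restrict_univ] at this
  have hterm : ∀ i, ∫ x in a ⁻¹' {i}, h (a x) ∂ν = ν.real (a ⁻¹' {i}) * h i := by
    intro i
    rw [setIntegral_congr_fun (g := fun _ => h i) (ha i) fun x hx => congrArg h hx,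
      setIntegral_const, smul_eq_mul]
  simpa only [hterm] using this

/-- Sums over a partition finer than `q` are close to the sums over `q` if the weighted
oscillation over `q` is small. -/
theorem abs_tsum_sub_sum_le {ι κ : Type*} [Fintype ι] [Countable κ] {ν : Measure T}
    [IsFiniteMeasure ν] {q : T → ι} (hq : HasMeasurableFibers q) {a : T → κ}
    (ha : HasMeasurableFibers a) (haq : IndexRefines a q) {f : T → ℝ} {M : ℝ}
    (hM : ∀ x, |f x| ≤ M) {w : ι → ℝ} (hw : ∀ x y, q x = q y → |f x - f y| ≤ w (q x))
    {t : κ → T} (ht : IsTagging (fun i => a ⁻¹' {i}) t)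
    {c : ι → T} (hc : IsTagging (fun i => q ⁻¹' {i}) c) :
    |∑' i, ν.real (a ⁻¹' {i}) * f (t i) - ∑ j, ν.real (q ⁻¹' {j}) * f (c j)|
      ≤ ∑ j, ν.real (q ⁻¹' {j}) * w j := by
  have h1 := ha.hasSum_integral (ν := ν) (h := fun i => f (t i)) fun i => hM _
  have h2 := hq.hasSum_integral (ν := ν) (h := fun i => f (c i)) fun i => hM _
  have hwM : ∀ j, |w j| ≤ ∑ j, |w j| := fun j =>
    Finset.single_le_sum (f := fun j => |w j|) (fun _ _ => abs_nonneg _) (Finset.mem_univ j)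
  have h3 := hq.hasSum_integral (ν := ν) hwM
  rw [h1.tsum_eq, ← tsum_fintype (L := .unconditional _), ← tsum_fintype (L := .unconditional _),
    h2.tsum_eq, h3.tsum_eq, ← integral_sub (ha.integrable fun i => hM _)
      (hq.integrable fun i => hM _), ← Real.norm_eq_abs]
  -- At `x` the two step functions are values of `f` at points in the `q`-fibre of `x`, so they
  -- differ by at most `w (q x)`.
  refine norm_integral_le_of_norm_le (hq.integrable hwM) (ae_of_all _ fun x => ?_)
  have e1 : a (t (a x)) = a x := ht (a x) ⟨x, rfl⟩
  have e2 : q (c (q x)) = q x := hc (q x) ⟨x, rfl⟩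
  have e3 : q (t (a x)) = q x := haq _ _ e1
  rw [Real.norm_eq_abs, ← e3]
  exact hw _ _ (by rw [e3, e2])

variable {μ : Set T → ℝ≥0} {ν : Measure T} [IsFiniteMeasure ν]

/-- If `μ - ν` has finite variation along the fibres of `a`, then sums against `μ` converge and are
close to the sums against `ν`. -/
theorem summable_and_abs_tsum_sub_le {κ : Type*} [Countable κ] {a : T → κ}
    (ha : HasMeasurableFibers a) {δ : ℝ}
    (hδ : ∀ S : Finset κ, ∑ i ∈ S, |(μ (a ⁻¹' {i}) : ℝ) - ν.real (a ⁻¹' {i})| ≤ δ)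
    {h : κ → ℝ} {M : ℝ} (hM0 : 0 ≤ M) (hM : ∀ i, |h i| ≤ M) :
    Summable (fun i => (μ (a ⁻¹' {i}) : ℝ) * h i) ∧
      |∑' i, (μ (a ⁻¹' {i}) : ℝ) * h i - ∑' i, ν.real (a ⁻¹' {i}) * h i| ≤ M * δ := by
  have hs := (ha.hasSum_integral (ν := ν) hM).summable
  have hbound : ∀ S : Finset κ,
      ∑ i ∈ S, |((μ (a ⁻¹' {i}) : ℝ) - ν.real (a ⁻¹' {i})) * h i| ≤ M * δ := by
    intro S
    refine le_trans ?_ (mul_le_mul_of_nonneg_left (hδ S) hM0)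
    rw [Finset.mul_sum]
    refine Finset.sum_le_sum fun i _ => ?_
    rw [abs_mul, mul_comm]
    exact mul_le_mul_of_nonneg_right (hM i) (abs_nonneg _)
  have hd : Summable fun i => |((μ (a ⁻¹' {i}) : ℝ) - ν.real (a ⁻¹' {i})) * h i| :=
    summable_of_sum_le (fun _ => abs_nonneg _) hbound
  have hμ : Summable fun i => (μ (a ⁻¹' {i}) : ℝ) * h i := by
    refine (hs.add hd.of_abs).congr fun i => ?_
    ring
  refine ⟨hμ, ?_⟩
  rw [← hμ.tsum_sub hs]
  have hnorm := norm_tsum_le_tsum_norm (f := fun i =>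
    ((μ (a ⁻¹' {i}) : ℝ) - ν.real (a ⁻¹' {i})) * h i) hd
  simp only [sub_mul] at hnorm hd hbound
  exact hnorm.trans (hd.tsum_le_of_sum_le hbound)

/-- The oscillation of `f` on `A`. -/
def oscOn {T : Type*} (f : T → ℝ) (A : Set T) : ℝ :=
  sSup {r | ∃ x ∈ A, ∃ y ∈ A, r = |f x - f y|}

omit [MeasurableSpace T] in
theorem abs_sub_le_two_mul {f : T → ℝ} {M : ℝ} (hM : ∀ x, |f x| ≤ M) (x y : T) :
    |f x - f y| ≤ 2 * M := by
  have h1 := abs_le.1 (hM x)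
  have h2 := abs_le.1 (hM y)
  rw [abs_le]
  constructor <;> linarith [h1.1, h1.2, h2.1, h2.2]

omit [MeasurableSpace T] in
theorem abs_sub_le_oscOn {f : T → ℝ} {M : ℝ} (hM : ∀ x, |f x| ≤ M) {A : Set T} {x y : T}
    (hx : x ∈ A) (hy : y ∈ A) : |f x - f y| ≤ oscOn f A := by
  refine le_csSup ⟨2 * M, ?_⟩ ⟨x, hx, y, hy, rfl⟩
  rintro _ ⟨x, -, y, -, rfl⟩
  exact abs_sub_le_two_mul hM x y

omit [MeasurableSpace T] in
theorem oscOn_nonneg (f : T → ℝ) (A : Set T) : 0 ≤ oscOn f A := by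
  refine Real.sSup_nonneg ?_
  rintro _ ⟨x, -, y, -, rfl⟩
  exact abs_nonneg _

omit [MeasurableSpace T] in
theorem oscOn_le {f : T → ℝ} {M : ℝ} (hM0 : 0 ≤ M) (hM : ∀ x, |f x| ≤ M) (A : Set T) :
    oscOn f A ≤ 2 * M := by
  refine Real.sSup_le ?_ (by positivity)
  rintro _ ⟨x, -, y, -, rfl⟩
  exact abs_sub_le_two_mul hM x y

omit [MeasurableSpace T] in
-- Tags can be chosen independently in each set, so that all oscillations are nearly attained at
-- once, at a cost `δ` times the total weight.
theorem sum_mul_oscOn_le [Nonempty T] {ι : Type*} (S : Finset ι) {A : ι → Set T} {c : ι → ℝ}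
    (hc : ∀ i, 0 ≤ c i) {f : T → ℝ} {ε : ℝ}
    (h : ∀ s t : ι → T, IsTagging A s → IsTagging A t →
      ∑ i ∈ S, c i * |f (s i) - f (t i)| ≤ ε) :
    ∑ i ∈ S, c i * oscOn f (A i) ≤ ε := by
  refine le_of_forall_pos_le_add fun η hη => ?_
  have hC : 0 ≤ ∑ i ∈ S, c i := Finset.sum_nonneg fun i _ => hc i
  obtain ⟨δ, hδ, hδη⟩ : ∃ δ : ℝ, 0 < δ ∧ (∑ i ∈ S, c i) * δ ≤ η := by
    refine ⟨η / (∑ i ∈ S, c i + 1), by positivity, ?_⟩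
    rw [mul_div_assoc', div_le_iff₀ (by positivity)]
    nlinarith
  have hex : ∀ i, ∃ x y : T, ((A i).Nonempty → x ∈ A i) ∧ ((A i).Nonempty → y ∈ A i) ∧
      oscOn f (A i) ≤ |f x - f y| + δ := by
    intro i
    rcases (A i).eq_empty_or_nonempty with hA | ⟨x, hx⟩
    · refine ⟨Classical.arbitrary T, Classical.arbitrary T, by simp [hA], by simp [hA], ?_⟩
      simp [hA, oscOn, hδ.le]
    · have hne : {r | ∃ x ∈ A i, ∃ y ∈ A i, r = |f x - f y|}.Nonempty := ⟨_, x, hx, x, hx, rfl⟩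
      obtain ⟨_, ⟨x, hx, y, hy, rfl⟩, hlt⟩ := exists_lt_of_lt_csSup hne
        (show oscOn f (A i) - δ < sSup _ from sub_lt_self _ hδ)
      exact ⟨x, y, fun _ => hx, fun _ => hy, by linarith⟩
  choose s t hs ht hst using hex
  calc ∑ i ∈ S, c i * oscOn f (A i)
      ≤ ∑ i ∈ S, (c i * |f (s i) - f (t i)| + c i * δ) :=
        Finset.sum_le_sum fun i _ => by
          rw [← mul_add]; exact mul_le_mul_of_nonneg_left (hst i) (hc i)
    _ = ∑ i ∈ S, c i * |f (s i) - f (t i)| + (∑ i ∈ S, c i) * δ := by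
        rw [Finset.sum_add_distrib, Finset.sum_mul]
    _ ≤ ε + η := add_le_add (h s t hs ht) hδη

/-- Uniformly over the family `f`, the weighted oscillations over suitable finite partitions are
arbitrarily small. -/
def HasSmallOscillation {Φ : Type*} (ν : Measure T) (f : Φ → T → ℝ) : Prop :=
  ∀ ε : ℝ, 0 < ε → ∀ (k : ℕ) (p : T → Fin k), HasMeasurableFibers p →
    ∃ (ι : Type) (_ : Fintype ι) (q : T → ι), HasMeasurableFibers q ∧ IndexRefines q p ∧
      ∀ b, ∃ w : ι → ℝ, (∀ x y, q x = q y → |f b x - f b y| ≤ w (q x)) ∧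
        ∑ j, ν.real (q ⁻¹' {j}) * w j ≤ ε

theorem HasMeasurableFibers.exists_measureReal_tail_le {a : T → ℕ} (ha : HasMeasurableFibers a)
    {ε : ℝ} (hε : 0 < ε) : ∃ N, ν.real (a ⁻¹' Ici N) ≤ ε := by
  have h := tendsto_measure_iInter_atTop (μ := ν) (s := fun N => a ⁻¹' Ici N)
    (fun N => (ha.measurableSet_preimage _).nullMeasurableSet)
    (fun m n hmn => preimage_mono (Ici_subset_Ici.2 hmn)) ⟨0, measure_ne_top _ _⟩
  have h0 : ⋂ N, a ⁻¹' Ici N = ∅ := by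
    ext x
    simp only [mem_iInter, mem_preimage, mem_Ici, mem_empty_iff_false, iff_false, not_forall]
    exact ⟨a x + 1, by omega⟩
  rw [h0, measure_empty] at h
  have h' := (ENNReal.tendsto_toReal ENNReal.zero_ne_top).comp h
  obtain ⟨N, hN⟩ := (h'.eventually (gt_mem_nhds hε)).exists
  exact ⟨N, le_of_lt hN⟩

/-- Cut the countable partition at `N`. The tail has small `ν`-measure and oscillation at most `2 *
M`. Elsewhere the `ν`-mass of a piece is at most its `μ`-mass plus an error of small total, and by
monotonicity the `μ`-mass is at most that of the whole set `a ⁻¹' {n}`. -/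
theorem hasSmallOscillation_of_forall_exists [Nonempty T] {Φ : Type*} {f : Φ → T → ℝ} {M : ℝ}
    (hM : ∀ b x, |f b x| ≤ M) (hM0 : 0 ≤ M) (hμ_mono : IsMonotoneSetFunction μ)
    (hμν : IsApproximatedBy μ ν)
    (h : ∀ ε : ℝ, 0 < ε → ∃ a : T → ℕ, HasMeasurableFibers a ∧
      ∀ N : ℕ, ∀ s t : Fin N → T, IsTagging (fun i : Fin N => a ⁻¹' {(i : ℕ)}) s →
        IsTagging (fun i : Fin N => a ⁻¹' {(i : ℕ)}) t → ∀ b,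
          ∑ i : Fin N, (μ (a ⁻¹' {(i : ℕ)}) : ℝ) * |f b (s i) - f b (t i)| ≤ ε) :
    HasSmallOscillation ν f := by
  intro ε hε k p hp
  obtain ⟨δ, hδ, hδε⟩ : ∃ δ : ℝ, 0 < δ ∧ 2 * M * δ ≤ ε / 3 := by
    refine ⟨ε / (6 * (M + 1)), by positivity, ?_⟩
    rw [mul_div_assoc', div_le_iff₀ (by positivity)]
    nlinarith
  obtain ⟨m, p', hp', hclose⟩ := hμν δ hδ
  set J := Fin k × Fin m
  let K : ℝ := Fintype.card J
  have hK : 0 ≤ K := Nat.cast_nonneg _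
  -- Without additivity of `μ`, cutting a set of `a` into `K` pieces may multiply its contribution
  -- by `K`. So `p'`, hence `K`, is fixed before `a` is chosen.
  obtain ⟨a, ha, hosc⟩ := h (ε / (3 * (K + 1))) (by positivity)
  obtain ⟨N, hN⟩ := ha.exists_measureReal_tail_le (ν := ν) hδ
  let r : T → Option (Fin N) := fun x => if hx : a x < N then some ⟨a x, hx⟩ else none
  have hrs : ∀ n : Fin N, r ⁻¹' {some n} = a ⁻¹' {(n : ℕ)} := by
    intro n
    ext x
    by_cases hx : a x < N
    · simp [r, hx, Fin.ext_iff]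
    · simp only [mem_preimage, hx, ↓reduceDIte, mem_singleton_iff, reduceCtorEq, false_iff, r]
      have := n.2
      omega
  have hrn : r ⁻¹' {none} = a ⁻¹' Ici N := by
    ext x
    by_cases hx : a x < N <;> simp [r, hx]
    exact not_lt.1 hx
  have hr : HasMeasurableFibers r := by
    rintro (_ | n)
    · rw [hrn]; exact ha.measurableSet_preimage _
    · rw [hrs]; exact ha _
  let q : T → Option (Fin N) × J := fun x => (r x, (p x, p' x))
  have hq : HasMeasurableFibers q := hr.prodMk (hp.prodMk hp')
  have hqp : IndexRefines q p := (IndexRefines.snd r _).trans (IndexRefines.fst p p')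
  have hqp' : IndexRefines q p' := (IndexRefines.snd r _).trans (IndexRefines.snd p p')
  have hqr : ∀ n j, q ⁻¹' {(n, j)} ⊆ r ⁻¹' {n} := by
    intro n j x hx
    exact (Prod.ext_iff.1 (show q x = (n, j) from hx)).1
  refine ⟨_, inferInstance, q, hq, hqp, fun b => ?_⟩
  let w : Option (Fin N) × J → ℝ := fun i =>
    i.1.elim (2 * M) fun n => oscOn (f b) (a ⁻¹' {(n : ℕ)})
  have hw0 : ∀ i, 0 ≤ w i := by
    rintro ⟨_ | n, j⟩
    · exact mul_nonneg zero_le_two hM0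
    · exact oscOn_nonneg _ _
  have hw1 : ∀ i, w i ≤ 2 * M := by
    rintro ⟨_ | n, j⟩
    · exact le_rfl
    · exact oscOn_le hM0 (hM b) _
  refine ⟨w, fun x y hxy => ?_, ?_⟩
  · rcases hx : q x with ⟨_ | n, j⟩
    · exact abs_sub_le_two_mul (hM b) x y
    · have hx' : x ∈ a ⁻¹' {(n : ℕ)} := hrs n ▸ hqr _ j hx
      have hy' : y ∈ a ⁻¹' {(n : ℕ)} := hrs n ▸ hqr _ j (hxy.symm.trans hx)
      exact abs_sub_le_oscOn (hM b) hx' hy'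
  · have hO := sum_mul_oscOn_le Finset.univ (A := fun i : Fin N => a ⁻¹' {(i : ℕ)})
      (c := fun i => (μ (a ⁻¹' {(i : ℕ)}) : ℝ)) (fun _ => NNReal.coe_nonneg _) (f := f b)
      fun s t hs ht => hosc N s t hs ht b
    have htail : ∑ j, ν.real (q ⁻¹' {(none, j)}) ≤ δ := by
      refine le_trans ?_ (hrn ▸ hN)
      rw [← measureReal_iUnion_fintype ?_ fun j => hq _]
      · exact measureReal_mono (iUnion_subset fun j => hqr _ j)
      · intro i j hij
        refine Set.disjoint_left.2 fun x hx hx' => hij ?_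
        exact (Prod.ext_iff.1 ((show q x = _ from hx).symm.trans hx')).2
    have hsome : ∑ n : Fin N, ∑ j, ν.real (q ⁻¹' {(some n, j)}) * w (some n, j)
        ≤ ∑ i, 2 * M * |(μ (q ⁻¹' {i}) : ℝ) - ν.real (q ⁻¹' {i})| + K * (ε / (3 * (K + 1))) := by
      have hterm : ∀ (n : Fin N) (j : J), ν.real (q ⁻¹' {(some n, j)}) * w (some n, j)
          ≤ 2 * M * |(μ (q ⁻¹' {(some n, j)}) : ℝ) - ν.real (q ⁻¹' {(some n, j)})|
            + (μ (a ⁻¹' {(n : ℕ)}) : ℝ) * oscOn (f b) (a ⁻¹' {(n : ℕ)}) := by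
        intro n j
        have h1 : (μ (q ⁻¹' {(some n, j)}) : ℝ) ≤ μ (a ⁻¹' {(n : ℕ)}) :=
          NNReal.coe_le_coe.2 (hμ_mono _ _ (hq _) (ha _) (hrs n ▸ hqr _ j))
        have h2 := mul_le_mul_of_nonneg_right h1 (hw0 (some n, j))
        have h3 := mul_le_mul_of_nonneg_left (hw1 (some n, j))
          (abs_nonneg ((μ (q ⁻¹' {(some n, j)}) : ℝ) - ν.real (q ⁻¹' {(some n, j)})))
        have h4 := mul_le_mul_of_nonneg_right
          (neg_le_abs ((μ (q ⁻¹' {(some n, j)}) : ℝ) - ν.real (q ⁻¹' {(some n, j)})))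
          (hw0 (some n, j))
        change _ ≤ _ + (μ (a ⁻¹' {(n : ℕ)}) : ℝ) * w (some n, j)
        linarith
      refine (Finset.sum_le_sum fun n _ => Finset.sum_le_sum fun j _ => hterm n j).trans ?_
      simp only [Finset.sum_add_distrib, Finset.sum_const, Finset.card_univ, nsmul_eq_mul]
      rw [Fintype.sum_prod_type, Fintype.sum_option, ← Finset.mul_sum]
      refine add_le_add (le_add_of_nonneg_left (Finset.sum_nonneg fun j _ => ?_))
        (mul_le_mul_of_nonneg_left hO hK)
      exact mul_nonneg (mul_nonneg zero_le_two hM0) (abs_nonneg _)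
    rw [Fintype.sum_prod_type, Fintype.sum_option]
    have hnone : ∑ j, ν.real (q ⁻¹' {(none, j)}) * w (none, j) ≤ 2 * M * δ := by
      change ∑ j, ν.real (q ⁻¹' {(none, j)}) * (2 * M) ≤ 2 * M * δ
      rw [← Finset.sum_mul, mul_comm]
      exact mul_le_mul_of_nonneg_left htail (mul_nonneg zero_le_two hM0)
    rw [← Finset.mul_sum] at hsome
    have h2 := mul_le_mul_of_nonneg_left (hclose _ q hq hqp' Finset.univ)
      (mul_nonneg zero_le_two hM0)
    have h3 : K * (ε / (3 * (K + 1))) ≤ ε / 3 := by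
      rw [mul_div_assoc', div_le_iff₀ (by positivity)]
      nlinarith
    linarith

end Oscillation

/-! ### The three integrals compared. -/

section Main

open MeasureTheory

variable {T : Type*} [MeasurableSpace T] {X : Type*} [NormedAddCommGroup X] [NormedSpace ℝ X]
  {μ : Set T → ℝ≥0} {ν : Measure T} [IsFiniteMeasure ν] {F : T → cwkSets X} {M : ℝ}

theorem abs_supOn_le {A : Set X} (hA : A.Nonempty) (hM : ∀ x ∈ A, ‖x‖ ≤ M)
    {φ : StrongDual ℝ X} (hφ : ‖φ‖ ≤ 1) : |supOn A φ| ≤ M := by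
  have hb : ∀ x ∈ A, |φ x| ≤ M := fun x hx =>
    (φ.le_of_opNorm_le hφ x).trans (by simpa using hM x hx)
  obtain ⟨x₀, hx₀⟩ := hA
  rw [abs_le]
  constructor
  · refine (neg_le_of_abs_le (hb x₀ hx₀)).trans (le_csSup ⟨M, ?_⟩ (mem_image_of_mem _ hx₀))
    rintro _ ⟨x, hx, rfl⟩
    exact (le_abs_self _).trans (hb x hx)
  · refine csSup_le ⟨_, mem_image_of_mem _ hx₀⟩ ?_
    rintro _ ⟨x, hx, rfl⟩
    exact (le_abs_self _).trans (hb x hx)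

omit [MeasurableSpace T] in
theorem exists_isTagging [Nonempty T] {ι : Type*} (A : ι → Set T) : ∃ t : ι → T, IsTagging A t := by
  have h : ∀ i, ∃ x, (A i).Nonempty → x ∈ A i := fun i => by
    by_cases hi : (A i).Nonempty
    · exact ⟨hi.some, fun _ => hi.some_mem⟩
    · exact ⟨Classical.arbitrary T, fun h => (hi h).elim⟩
  exact Classical.axiomOfChoice h

omit [MeasurableSpace T] in
theorem sum_smul_mem_cwkSets {ι : Type*} (s : Finset ι) (c : ι → ℝ) (t : ι → T) :
    ∑ i ∈ s, c i • (F (t i) : Set X) ∈ cwkSets X :=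
  sum_mem_cwkSets s fun i => smul_mem_cwkSets _ (F (t i)).2

omit [MeasurableSpace T] in
theorem supOn_sum_smul {ι : Type*} (s : Finset ι) {c : ι → ℝ} (hc : ∀ i, 0 ≤ c i) (t : ι → T)
    (φ : StrongDual ℝ X) : supOn (∑ i ∈ s, c i • (F (t i) : Set X)) φ
      = ∑ i ∈ s, c i * supOn (F (t i) : Set X) φ := by
  rw [supOn_sum s fun i => smul_mem_cwkSets _ (F (t i)).2]
  exact Finset.sum_congr rfl fun i _ => supOn_smul (hc i) _ φ

/-- The support functions of the values of `F`, indexed by the dual unit ball. -/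
def supportFamily (F : T → cwkSets X) (b : Metric.closedBall (0 : StrongDual ℝ X) 1) (x : T) : ℝ :=
  supOn (F x : Set X) b

theorem norm_closedBall_le (b : Metric.closedBall (0 : StrongDual ℝ X) 1) :
    ‖(b : StrongDual ℝ X)‖ ≤ 1 := mem_closedBall_zero_iff.1 b.2

omit [MeasurableSpace T] in
theorem abs_supportFamily_le (hM : ∀ t, ∀ x ∈ (F t : Set X), ‖x‖ ≤ M)
    (b : Metric.closedBall (0 : StrongDual ℝ X) 1) (x : T) : |supportFamily F b x| ≤ M :=
  abs_supOn_le (F x).2.1 (hM x) (norm_closedBall_le b)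

/-- The set `I` is the limit of the sums of `F` along countable partitions. -/
def IsPartitionLimit (μ : Set T → ℝ≥0) (F : T → cwkSets X) (I : Set X) : Prop :=
  ∀ ε : ℝ, 0 < ε → ∃ (ι : Type) (_ : Fintype ι) (q : T → ι), HasMeasurableFibers q ∧
    ∀ (κ : Type) [Countable κ] (a : T → κ), HasMeasurableFibers a → IndexRefines a q →
      Summable (fun i => (μ (a ⁻¹' {i}) : ℝ)) ∧
      ∀ t : κ → T, IsTagging (fun i => a ⁻¹' {i}) t →
        ∀ b, |∑' i, (μ (a ⁻¹' {i}) : ℝ) * supportFamily F b (t i) - supOn I b| ≤ ε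

theorem forall_norm_le_one_of_closedBall {P : StrongDual ℝ X → Prop}
    (h : ∀ b : Metric.closedBall (0 : StrongDual ℝ X) 1, P b) (φ : StrongDual ℝ X)
    (hφ : ‖φ‖ ≤ 1) : P φ := h ⟨φ, mem_closedBall_zero_iff.2 hφ⟩

/-- Replacing `μ` by `ν` costs `M * δ` on each of the two partitions, and the oscillation bounds the
difference of the `ν`-sums. The resulting sets form a Cauchy sequence in `cwkSets X`. -/
theorem exists_isPartitionLimit [Nonempty T] [CompleteSpace X]
    (hM : ∀ t, ∀ x ∈ (F t : Set X), ‖x‖ ≤ M) (hM0 : 0 ≤ M)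
    (hμν : IsApproximatedBy μ ν) (h : HasSmallOscillation ν (supportFamily F)) :
    ∃ I ∈ cwkSets X, IsPartitionLimit μ F I := by
  have hfM := abs_supportFamily_le hM
  -- sums over partitions finer than a suitable one are close to a fixed set
  have key : ∀ ε : ℝ, 0 < ε → ∃ (ι : Type) (_ : Fintype ι) (q : T → ι) (K : Set X),
      HasMeasurableFibers q ∧ K ∈ cwkSets X ∧
      ∀ (κ : Type) [Countable κ] (a : T → κ), HasMeasurableFibers a → IndexRefines a q →
        Summable (fun i => (μ (a ⁻¹' {i}) : ℝ)) ∧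
        ∀ t : κ → T, IsTagging (fun i => a ⁻¹' {i}) t →
          ∀ b, |∑' i, (μ (a ⁻¹' {i}) : ℝ) * supportFamily F b (t i) - supOn K b| ≤ ε := by
    intro ε hε
    obtain ⟨δ, hδ, hδε⟩ : ∃ δ : ℝ, 0 < δ ∧ 2 * (M * δ) ≤ ε / 2 := by
      refine ⟨ε / (4 * (M + 1)), by positivity, ?_⟩
      rw [mul_div_assoc', mul_div_assoc', div_le_iff₀ (by positivity)]
      nlinarith
    obtain ⟨k, p, hp, hclose⟩ := hμν δ hδ
    obtain ⟨ι, _, q, hq, hqp, hw⟩ := h (ε / 2) (by positivity) k p hp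
    obtain ⟨c, hc⟩ := exists_isTagging (fun i => q ⁻¹' {i})
    refine ⟨ι, inferInstance, q, ∑ i, (μ (q ⁻¹' {i}) : ℝ) • (F (c i) : Set X), hq,
      sum_smul_mem_cwkSets _ _ _, fun κ _ a ha haq => ⟨?_, fun t ht b => ?_⟩⟩
    · simpa using (summable_and_abs_tsum_sub_le ha (hclose κ a ha (haq.trans hqp))
        (h := fun _ => 1) zero_le_one (by simp)).1
    · obtain ⟨w, hw1, hw2⟩ := hw b
      rw [supOn_sum_smul _ (fun _ => NNReal.coe_nonneg _)]
      have h1 := (summable_and_abs_tsum_sub_le ha (hclose κ a ha (haq.trans hqp))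
        (h := fun i => supportFamily F b (t i)) hM0 fun i => hfM b _).2
      have h2 := (summable_and_abs_tsum_sub_le hq (hclose ι q hq hqp)
        (h := fun i => supportFamily F b (c i)) hM0 fun i => hfM b _).2
      have h3 := (abs_tsum_sub_sum_le (ν := ν) hq ha haq (hfM b) hw1 ht hc).trans hw2
      rw [tsum_fintype, tsum_fintype] at h2
      change |_ - ∑ i, (μ (q ⁻¹' {i}) : ℝ) * supportFamily F b (c i)| ≤ ε
      rw [abs_le] at *
      constructor <;> linarith [h1.1, h1.2, h2.1, h2.2, h3.1, h3.2]
  choose ι inst q K hq hK hlim using fun n : ℕ => key (1 / ((n : ℝ) + 1)) (by positivity)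
  have hKK : ∀ m n, Metric.hausdorffEDist (K m) (K n)
      ≤ ENNReal.ofReal (1 / ((m : ℝ) + 1) + 1 / ((n : ℝ) + 1)) := by
    intro m n
    refine hausdorffEDist_le_of_forall_abs_supOn_sub_le (hK m) (hK n) (by positivity)
      (forall_norm_le_one_of_closedBall fun b => ?_)
    -- One tagged sum over the common refinement is close to both `K m` and `K n`.
    obtain ⟨t, ht⟩ := exists_isTagging (fun i => (fun x => (q m x, q n x)) ⁻¹' {i})
    have h1 := abs_le.1 ((hlim m _ _ ((hq m).prodMk (hq n)) (IndexRefines.fst _ _)).2 t ht b)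
    have h2 := abs_le.1 ((hlim n _ _ ((hq m).prodMk (hq n)) (IndexRefines.snd _ _)).2 t ht b)
    rw [abs_le]
    constructor <;> linarith [h1.1, h1.2, h2.1, h2.2]
  obtain ⟨I, hI, hKI⟩ := exists_limit_mem_cwkSets hK tendsto_one_div_add_atTop_nhds_zero_nat hKK
  refine ⟨I, hI, fun ε hε => ?_⟩
  obtain ⟨n, hn⟩ := exists_nat_one_div_lt (half_pos hε)
  refine ⟨ι n, inst n, q n, hq n, fun κ _ a ha haq => ⟨(hlim n κ a ha haq).1, fun t ht b => ?_⟩⟩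
  have h1 := abs_le.1 ((hlim n κ a ha haq).2 t ht b)
  have h2 := abs_le.1 (abs_supOn_sub_le_of_hausdorffEDist_le (hK n) hI (by positivity) (hKI n)
    (norm_closedBall_le b))
  rw [abs_le]
  constructor <;> linarith [h1.1, h1.2, h2.1, h2.2]

/-- The bound involves only `c` and `M`, so the partial sums converge uniformly over tags and over
the dual unit ball. -/
theorem abs_sum_range_sub_tsum_le {c h : ℕ → ℝ} (hc : Summable c) (hc0 : ∀ i, 0 ≤ c i)
    (hM : ∀ i, |h i| ≤ M) (n : ℕ) :
    |∑ i ∈ Finset.range n, c i * h i - ∑' i, c i * h i| ≤ M * ∑' i, c (i + n) := by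
  have hb : ∀ i, ‖c i * h i‖ ≤ M * c i := fun i => by
    rw [Real.norm_eq_abs, abs_mul, abs_of_nonneg (hc0 i), mul_comm]
    exact mul_le_mul_of_nonneg_right (hM i) (hc0 i)
  have hs : Summable fun i => c i * h i := Summable.of_norm_bounded (hc.mul_left M) hb
  rw [← hs.sum_add_tsum_nat_add n, sub_add_cancel_left, abs_neg, ← tsum_mul_left]
  exact tsum_of_norm_bounded (((summable_nat_add_iff n).2 hc).mul_left M).hasSum
    fun i => hb (i + n)

theorem IsPartitionLimit.birkhoffSimpleIntegrable {𝒞 : Set (Set X)}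
    (hM : ∀ t, ∀ x ∈ (F t : Set X), ‖x‖ ≤ M) (h𝒞 : cwkSets X ⊆ 𝒞) {I : Set X}
    (hI : I ∈ cwkSets X) (h : IsPartitionLimit μ F I) :
    BirkhoffSimpleIntegrable 𝒞 μ fun t => (F t : Set X) := by
  refine ⟨I, h𝒞 hI, isClosed_of_mem_cwkSets hI, fun ε hε => ?_⟩
  obtain ⟨ι, _, q, hq, hlim⟩ := h (ε / 2) (by positivity)
  obtain ⟨e, he⟩ := exists_injective_nat ι
  refine ⟨fun i => (e ∘ q) ⁻¹' {i}, (hq.comp_injective he).isCountablePartition,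
    fun A hA hAP t ht => ?_⟩
  obtain ⟨a, ha, rfl⟩ := hA.exists_index
  have haq : IndexRefines a q := (indexRefines_of_isFiner hAP).trans fun x y hxy => he hxy
  obtain ⟨hs, hclose⟩ := hlim ℕ a ha haq
  have htail : Tendsto (fun n => M * ∑' i, (μ (a ⁻¹' {i + n}) : ℝ)) atTop (𝓝 0) := by
    have := (tendsto_sum_nat_add fun i => (μ (a ⁻¹' {i}) : ℝ)).const_mul M
    rwa [mul_zero] at this
  refine limsup_le_of_le (h := ?_)
  filter_upwards [htail.eventually (gt_mem_nhds (half_pos hε))] with n hn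
  rw [closedSum_eq _ fun i => smul_mem_cwkSets _ (F (t i)).2]
  refine hausdorffEDist_le_of_forall_abs_supOn_sub_le (sum_smul_mem_cwkSets _ _ _) hI hε.le
    (forall_norm_le_one_of_closedBall fun b => ?_)
  rw [supOn_sum_smul _ (fun _ => NNReal.coe_nonneg _)]
  have h1 := abs_le.1 (hclose t ht b)
  have h2 := abs_le.1 (abs_sum_range_sub_tsum_le hs (fun _ => NNReal.coe_nonneg _)
    (h := fun i => supportFamily F b (t i)) (fun i => abs_supportFamily_le hM b _) n)
  change |∑ i ∈ Finset.range n, (μ (a ⁻¹' {i}) : ℝ) * supportFamily F b (t i) - _| ≤ ε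
  rw [abs_le]
  constructor <;> linarith [h1.1, h1.2, h2.1, h2.2]

theorem IsPartitionLimit.gouldIntegrable {I : Set X} (hI : I ∈ cwkSets X)
    (h : IsPartitionLimit μ F I) : GouldIntegrable μ fun t => (F t : Set X) := by
  refine ⟨I, ⟨hI.1, isBounded_of_mem_cwkSets hI, isClosed_of_mem_cwkSets hI⟩, fun ε hε => ?_⟩
  obtain ⟨ι, _, q, hq, hlim⟩ := h (ε / 2) (by positivity)
  obtain ⟨m, e, -, -, hP⟩ := hq.exists_isFinitePartition
  refine ⟨m, _, hP, fun n A hA hAP t ht => ?_⟩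
  obtain ⟨a, ha, rfl⟩ := hA.exists_index
  have haq : IndexRefines a q := indexRefines_of_isFiner fun i => by
    obtain ⟨j, hj⟩ := hAP i
    exact ⟨e j, hj⟩
  obtain ⟨-, hclose⟩ := hlim (Fin n) a ha haq
  rw [closedSum_eq _ fun i => smul_mem_cwkSets _ (F (t i)).2]
  refine lt_of_le_of_lt (b := ENNReal.ofReal (ε / 2)) ?_
    ((ENNReal.ofReal_lt_ofReal_iff hε).2 (half_lt_self hε))
  refine hausdorffEDist_le_of_forall_abs_supOn_sub_le (sum_smul_mem_cwkSets _ _ _) hI (by positivity)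
    (forall_norm_le_one_of_closedBall fun b => ?_)
  rw [supOn_sum_smul _ (fun _ => NNReal.coe_nonneg _)]
  have := hclose t ht b
  rwa [tsum_fintype] at this

omit [MeasurableSpace T] in
theorem norm_radstrom_le (hM : ∀ t, ∀ x ∈ (F t : Set X), ‖x‖ ≤ M) (hM0 : 0 ≤ M) (x : T) :
    ‖radstrom (F x)‖ ≤ M :=
  lp.norm_le_of_forall_le hM0 fun b => abs_supportFamily_le hM b x

omit [MeasurableSpace T] in
theorem tsum_smul_radstrom_apply {c : ℕ → ℝ} {t : ℕ → T}
    (hs : Summable fun n => c n • radstrom (F (t n)))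
    (b : Metric.closedBall (0 : StrongDual ℝ X) 1) :
    (∑' n, c n • radstrom (F (t n))) b = ∑' n, c n * supportFamily F b (t n) ∧
      Summable fun n => c n * supportFamily F b (t n) := by
  have : Fact ((1 : ℝ≥0∞) ≤ ∞) := ⟨le_top⟩
  have := hs.hasSum.mapL
    (lp.evalCLM ℝ (fun _ : Metric.closedBall (0 : StrongDual ℝ X) 1 => ℝ) ∞ b)
  exact ⟨this.tsum_eq.symm, this.summable⟩

/-- To prove Birkhoff integrability it suffices to bound the differences of the support
functions, over any countable partition with summable measures. -/
theorem birkhoffIntegrableMulti_of_forall_exists (hμ_empty : μ ∅ = 0)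
    (hM : ∀ t, ∀ x ∈ (F t : Set X), ‖x‖ ≤ M) (hM0 : 0 ≤ M)
    (h : ∀ ε : ℝ, 0 < ε → ∃ (κ : Type) (_ : Countable κ) (a : T → κ), HasMeasurableFibers a ∧
      Summable (fun i => (μ (a ⁻¹' {i}) : ℝ)) ∧ ∀ s t : κ → T,
        IsTagging (fun i => a ⁻¹' {i}) s → IsTagging (fun i => a ⁻¹' {i}) t → ∀ b,
          |∑' i, (μ (a ⁻¹' {i}) : ℝ) * supportFamily F b (s i)
            - ∑' i, (μ (a ⁻¹' {i}) : ℝ) * supportFamily F b (t i)| ≤ ε) :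
    BirkhoffIntegrableMulti μ F := by
  intro ε hε
  obtain ⟨κ, _, a, ha, hsum, hdiff⟩ := h ε hε
  obtain ⟨e, he⟩ := exists_injective_nat κ
  have hfib : ∀ i, (e ∘ a) ⁻¹' {e i} = a ⁻¹' {i} := fun i => by
    ext x; simp [he.eq_iff]
  -- Reindexing by `ℕ` only adds empty fibres, which have mass zero.
  have hout : ∀ n, n ∉ range e → (μ ((e ∘ a) ⁻¹' {n}) : ℝ) = 0 := by
    intro n hn
    rw [preimage_singleton_eq_empty.2 (fun h => hn (range_comp_subset_range a e h)), hμ_empty,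
      NNReal.coe_zero]
  have hsum' : Summable fun n => (μ ((e ∘ a) ⁻¹' {n}) : ℝ) := by
    refine (he.summable_iff hout).1 ?_
    exact hsum.congr fun i => by rw [Function.comp_apply, hfib]
  have hsm : ∀ t : ℕ → T, Summable fun n => (μ ((e ∘ a) ⁻¹' {n}) : ℝ) • radstrom (F (t n)) := by
    intro t
    refine Summable.of_norm_bounded (hsum'.mul_right M) fun n => ?_
    rw [norm_smul, Real.norm_of_nonneg (NNReal.coe_nonneg _)]
    exact mul_le_mul_of_nonneg_left (norm_radstrom_le hM hM0 _) (NNReal.coe_nonneg _)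
  refine ⟨fun n => (e ∘ a) ⁻¹' {n}, (ha.comp_injective he).isCountablePartition,
    fun t _ => hsm t, fun s t hs ht => ?_⟩
  rw [dist_eq_norm]
  refine lp.norm_le_of_forall_le hε.le fun b => ?_
  rw [lp.coeFn_sub, Pi.sub_apply, (tsum_smul_radstrom_apply (hsm s) b).1,
    (tsum_smul_radstrom_apply (hsm t) b).1, Real.norm_eq_abs]
  have hred : ∀ t : ℕ → T, ∑' n, (μ ((e ∘ a) ⁻¹' {n}) : ℝ) * supportFamily F b (t n)
      = ∑' i, (μ (a ⁻¹' {i}) : ℝ) * supportFamily F b (t (e i)) := by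
    intro t
    rw [← he.tsum_eq (f := fun n => (μ ((e ∘ a) ⁻¹' {n}) : ℝ) * supportFamily F b (t n))]
    · simp only [hfib]
    · intro n hn
      by_contra hne
      exact hn (by simp only [hout n hne, zero_mul])
  have htag : ∀ t : ℕ → T, IsTagging (fun n => (e ∘ a) ⁻¹' {n}) t →
      IsTagging (fun i => a ⁻¹' {i}) fun i => t (e i) := by
    intro t ht i hi
    have := ht (e i)
    simp only [hfib] at this
    exact this hi
  rw [hred, hred]
  exact hdiff _ _ (htag s hs) (htag t ht) b

/-- Two taggings of the same finite partition give sums within `ε / 2` of `I`; summability is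
trivial. -/
theorem GouldIntegrable.birkhoffIntegrableMulti (hμ_empty : μ ∅ = 0)
    (hM : ∀ t, ∀ x ∈ (F t : Set X), ‖x‖ ≤ M) (hM0 : 0 ≤ M)
    (h : GouldIntegrable μ fun t => (F t : Set X)) : BirkhoffIntegrableMulti μ F := by
  obtain ⟨I, -, hI⟩ := h
  refine birkhoffIntegrableMulti_of_forall_exists hμ_empty hM hM0 fun ε hε => ?_
  obtain ⟨m, P, hP, h⟩ := hI (ε / 2) (by positivity)
  obtain ⟨p, hp, rfl⟩ := id hP.exists_index
  refine ⟨Fin m, inferInstance, p, hp, (hasSum_fintype _).summable, fun s t hs ht b => ?_⟩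
  have hd : Metric.hausdorffEDist (∑ i, (μ (p ⁻¹' {i}) : ℝ) • (F (s i) : Set X))
      (∑ i, (μ (p ⁻¹' {i}) : ℝ) • (F (t i) : Set X)) ≤ ENNReal.ofReal ε := by
    have h1 := h m _ hP (fun i => ⟨i, subset_rfl⟩) s hs
    have h2 := h m _ hP (fun i => ⟨i, subset_rfl⟩) t ht
    rw [closedSum_eq _ fun i => smul_mem_cwkSets _ (F _).2] at h1 h2
    rw [Metric.hausdorffEDist_comm] at h2
    refine (Metric.hausdorffEDist_triangle (t := I)).trans ((add_le_add h1.le h2.le).trans ?_)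
    rw [← ENNReal.ofReal_add (by positivity) (by positivity), add_halves]
  have := abs_supOn_sub_le_of_hausdorffEDist_le (sum_smul_mem_cwkSets _ _ _)
    (sum_smul_mem_cwkSets _ _ _) hε.le hd (norm_closedBall_le b)
  rw [supOn_sum_smul _ (fun _ => NNReal.coe_nonneg _),
    supOn_sum_smul _ (fun _ => NNReal.coe_nonneg _)] at this
  rw [tsum_fintype, tsum_fintype]
  exact this

theorem BirkhoffSimpleIntegrable.birkhoffIntegrableMulti {𝒞 : Set (Set X)} (hμ_empty : μ ∅ = 0)
    (hμν : IsApproximatedBy μ ν)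
    (hM : ∀ t, ∀ x ∈ (F t : Set X), ‖x‖ ≤ M) (hM0 : 0 ≤ M)
    (h : BirkhoffSimpleIntegrable 𝒞 μ fun t => (F t : Set X)) : BirkhoffIntegrableMulti μ F := by
  obtain ⟨I, -, -, hI⟩ := h
  -- Refining by `p` makes the masses summable, which the convergence of partial sums in the
  -- Hausdorff distance does not provide; any finite bound on the variation would do.
  obtain ⟨k, p, hp, hclose⟩ := hμν 1 one_pos
  refine birkhoffIntegrableMulti_of_forall_exists hμ_empty hM hM0 fun ε hε => ?_
  obtain ⟨P, hP, h⟩ := hI (ε / 4) (by positivity)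
  obtain ⟨q, hq, rfl⟩ := hP.exists_index
  obtain ⟨e, he⟩ := exists_injective_nat (ℕ × Fin k)
  let a : T → ℕ := e ∘ fun x => (q x, p x)
  have ha : HasMeasurableFibers a := (hq.prodMk hp).comp_injective he
  have haqp : IndexRefines a fun x => (q x, p x) := fun x y hxy => he hxy
  have haq := haqp.trans (IndexRefines.fst q p)
  have hap := haqp.trans (IndexRefines.snd q p)
  have hsum : ∀ (h : ℕ → ℝ) (C : ℝ), 0 ≤ C → (∀ i, |h i| ≤ C) →
      Summable fun i => (μ (a ⁻¹' {i}) : ℝ) * h i := fun h C hC hh =>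
    (summable_and_abs_tsum_sub_le ha (hclose ℕ a ha hap) hC hh).1
  refine ⟨ℕ, inferInstance, a, ha, by simpa using hsum (fun _ => 1) 1 zero_le_one (by simp),
    fun s t hs ht b => ?_⟩
  have hev : ∀ t : ℕ → T, IsTagging (fun i => a ⁻¹' {i}) t → ∀ᶠ n in atTop,
      Metric.hausdorffEDist (∑ i ∈ Finset.range n, (μ (a ⁻¹' {i}) : ℝ) • (F (t i) : Set X)) I
        < ENNReal.ofReal (ε / 2) := by
    intro t ht
    have h1 := h _ ha.isCountablePartition (isFiner_of_indexRefines haq) t ht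
    have h2 := eventually_lt_of_limsup_lt (h1.trans_lt
      ((ENNReal.ofReal_lt_ofReal_iff (half_pos hε)).2 (by linarith : ε / 4 < ε / 2)))
    filter_upwards [h2] with n hn
    rwa [closedSum_eq _ fun i => smul_mem_cwkSets _ (F _).2] at hn
  have ht1 : ∀ t : ℕ → T, Tendsto (fun n => ∑ i ∈ Finset.range n,
      (μ (a ⁻¹' {i}) : ℝ) * supportFamily F b (t i)) atTop
      (𝓝 (∑' i, (μ (a ⁻¹' {i}) : ℝ) * supportFamily F b (t i))) := fun t =>
    (hsum (fun i => supportFamily F b (t i)) M hM0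
      fun i => abs_supportFamily_le hM b _).hasSum.tendsto_sum_nat
  -- For each functional the series converge, so the estimate for large partial sums passes to the
  -- limit.
  refine le_of_tendsto ((ht1 s).sub (ht1 t)).abs ?_
  filter_upwards [hev s hs, hev t ht] with n h1 h2
  rw [Metric.hausdorffEDist_comm] at h2
  have hd := (Metric.hausdorffEDist_triangle (t := I)).trans (add_le_add h1.le h2.le)
  rw [← ENNReal.ofReal_add (by positivity) (by positivity), add_halves] at hd
  have := abs_supOn_sub_le_of_hausdorffEDist_le (sum_smul_mem_cwkSets _ _ _)
    (sum_smul_mem_cwkSets _ _ _) hε.le hd (norm_closedBall_le b)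
  rwa [supOn_sum_smul _ (fun _ => NNReal.coe_nonneg _),
    supOn_sum_smul _ (fun _ => NNReal.coe_nonneg _)] at this

/-- For a fixed functional, exchanging tags makes a difference of two sums into a sum of absolute
values. The partition does not depend on the functional, so the bound is uniform. -/
theorem BirkhoffIntegrableMulti.hasSmallOscillation [Nonempty T]
    (hμ_mono : IsMonotoneSetFunction μ) (hμν : IsApproximatedBy μ ν)
    (hM : ∀ t, ∀ x ∈ (F t : Set X), ‖x‖ ≤ M) (hM0 : 0 ≤ M)
    (h : BirkhoffIntegrableMulti μ F) : HasSmallOscillation ν (supportFamily F) := by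
  classical
  refine hasSmallOscillation_of_forall_exists (abs_supportFamily_le hM) hM0 hμ_mono hμν
    fun ε hε => ?_
  obtain ⟨A, hA, hsum, hdist⟩ := h ε hε
  obtain ⟨a, ha, rfl⟩ := hA.exists_index
  refine ⟨a, ha, fun N s t hs ht b => ?_⟩
  obtain ⟨c, hc⟩ := exists_isTagging (fun i => a ⁻¹' {i})
  -- swap the tags so that all the differences become nonnegative
  let f := supportFamily F b
  let s' : ℕ → T := fun n => if hn : n < N then
    (if f (t ⟨n, hn⟩) ≤ f (s ⟨n, hn⟩) then s ⟨n, hn⟩ else t ⟨n, hn⟩) else c n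
  let t' : ℕ → T := fun n => if hn : n < N then
    (if f (t ⟨n, hn⟩) ≤ f (s ⟨n, hn⟩) then t ⟨n, hn⟩ else s ⟨n, hn⟩) else c n
  have hs' : IsTagging (fun i => a ⁻¹' {i}) s' := by
    intro n hne
    by_cases hn : n < N
    · simp only [s', hn, ↓reduceDIte]
      split_ifs
      · exact hs ⟨n, hn⟩ hne
      · exact ht ⟨n, hn⟩ hne
    · simp only [s', hn, ↓reduceDIte]
      exact hc n hne
  have ht' : IsTagging (fun i => a ⁻¹' {i}) t' := by
    intro n hne
    by_cases hn : n < N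
    · simp only [t', hn, ↓reduceDIte]
      split_ifs
      · exact ht ⟨n, hn⟩ hne
      · exact hs ⟨n, hn⟩ hne
    · simp only [t', hn, ↓reduceDIte]
      exact hc n hne
  have hle : |(∑' n, (μ (a ⁻¹' {n}) : ℝ) • radstrom (F (s' n))) b
      - (∑' n, (μ (a ⁻¹' {n}) : ℝ) • radstrom (F (t' n))) b| ≤ ε := by
    have h1 := hdist s' t' hs' ht'
    rw [dist_eq_norm] at h1
    have h2 := lp.norm_apply_le_norm ENNReal.top_ne_zero
      (∑' n, (μ (a ⁻¹' {n}) : ℝ) • radstrom (F (s' n))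
        - ∑' n, (μ (a ⁻¹' {n}) : ℝ) • radstrom (F (t' n))) b
    rw [lp.coeFn_sub, Pi.sub_apply, Real.norm_eq_abs] at h2
    exact h2.trans h1
  obtain ⟨es, hss⟩ := tsum_smul_radstrom_apply (hsum s' hs') b
  obtain ⟨et, hst⟩ := tsum_smul_radstrom_apply (hsum t' ht') b
  rw [es, et, ← hss.tsum_sub hst] at hle
  refine le_trans (le_of_eq ?_) ((le_abs_self _).trans hle)
  rw [tsum_eq_sum (s := Finset.range N), Finset.sum_range]
  · refine Finset.sum_congr rfl fun i _ => ?_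
    rw [← mul_sub]
    congr 1
    change |f (s i) - f (t i)| = f (s' i) - f (t' i)
    by_cases hi : f (t i) ≤ f (s i)
    · simp only [s', t', i.2, ↓reduceDIte, hi, ↓reduceIte, Fin.eta]
      exact abs_of_nonneg (sub_nonneg.2 hi)
    · simp only [s', t', i.2, ↓reduceDIte, hi, ↓reduceIte, Fin.eta]
      rw [abs_of_neg (by linarith), neg_sub]
  · intro n hn
    have hn : ¬ n < N := fun h => hn (Finset.mem_range.2 h)
    simp only [s', t', hn, ↓reduceDIte, sub_self]

theorem birkhoffIntegrableMulti_of_isEmpty [IsEmpty T] : BirkhoffIntegrableMulti μ F := fun _ _ =>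
  ⟨fun _ => ∅, ⟨fun _ => MeasurableSet.empty, fun _ _ _ => Set.disjoint_empty _,
    Subsingleton.elim _ _⟩, fun t => isEmptyElim (t 0), fun t => isEmptyElim (t 0)⟩

theorem birkhoffSimpleIntegrable_of_isEmpty [IsEmpty T] {𝒞 : Set (Set X)}
    (h𝒞 : cwkSets X ⊆ 𝒞) : BirkhoffSimpleIntegrable 𝒞 μ fun t => (F t : Set X) :=
  ⟨0, h𝒞 zero_mem_cwkSets, isClosed_of_mem_cwkSets zero_mem_cwkSets, fun _ _ =>
    ⟨fun _ => ∅, ⟨fun _ => MeasurableSet.empty, fun _ _ _ => Set.disjoint_empty _,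
      Subsingleton.elim _ _⟩, fun _ _ _ t => isEmptyElim (t 0)⟩⟩

theorem gouldIntegrable_of_isEmpty [IsEmpty T] : GouldIntegrable μ fun t => (F t : Set X) := by
  refine ⟨0, ⟨zero_mem_cwkSets.1, isBounded_of_mem_cwkSets zero_mem_cwkSets,
    isClosed_of_mem_cwkSets zero_mem_cwkSets⟩, fun ε hε => ⟨0, fun _ => ∅,
      ⟨fun i => i.elim0, fun i => i.elim0, fun i => i.elim0, Subsingleton.elim _ _⟩,
      fun n A hA _ t _ => ?_⟩⟩
  obtain rfl : n = 0 := by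
    rcases n with _ | n
    · rfl
    · exact isEmptyElim (t 0)
  rw [closedSum_eq _ fun i => smul_mem_cwkSets _ (F (t i)).2]
  simpa using hε

end Main

end

theorem theorem3p13 {T : Type*} [MeasurableSpace T]
    {X : Type*} [NormedAddCommGroup X] [NormedSpace ℝ X] [CompleteSpace X]
    (μ : Set T → ℝ≥0) (hμ_empty : μ ∅ = 0) (hμ_mono : IsMonotoneSetFunction μ)
    (hμ_int : IsIntegrableSetFunction μ) (hμ_cont : IsContinuousFromBelow μ)
    (𝒞 : Set (Set X)) (h𝒞 : cwkSets X ⊆ 𝒞) (h𝒞b : 𝒞 ⊆ bSets X)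
    (F : T → cwkSets X) (hF : IsBoundedMultifunction fun t => (F t : Set X)) :
    (BirkhoffSimpleIntegrable 𝒞 μ (fun t => (F t : Set X)) ↔ BirkhoffIntegrableMulti μ F) ∧
    (BirkhoffSimpleIntegrable 𝒞 μ (fun t => (F t : Set X)) ↔
      GouldIntegrable μ (fun t => (F t : Set X))) := by
  -- Choosing tags requires a point of `T`. For empty `T` there are no sequences of tags, and the
  -- only Gould sum is the empty one, equal to `0`.
  rcases isEmpty_or_nonempty T with hT | hT
  · have h1 : BirkhoffSimpleIntegrable 𝒞 μ fun t => (F t : Set X) :=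
      birkhoffSimpleIntegrable_of_isEmpty h𝒞
    exact ⟨iff_of_true h1 birkhoffIntegrableMulti_of_isEmpty,
      iff_of_true h1 gouldIntegrable_of_isEmpty⟩
  obtain ⟨M', hM'⟩ := hF
  obtain ⟨M, hM0, hM⟩ : ∃ M : ℝ, 0 ≤ M ∧ ∀ t, ∀ x ∈ (F t : Set X), ‖x‖ ≤ M :=
    ⟨max M' 0, le_max_right _ _, fun t x hx => (hM' t x hx).trans (le_max_left _ _)⟩
  obtain ⟨ν, _, hμν⟩ := exists_isApproximatedBy hμ_empty hμ_int hμ_cont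
  have hlim (h : BirkhoffIntegrableMulti μ F) : ∃ I ∈ cwkSets X, IsPartitionLimit μ F I :=
    exists_isPartitionLimit hM hM0 hμν (h.hasSmallOscillation hμ_mono hμν hM hM0)
  have hSB (h : BirkhoffSimpleIntegrable 𝒞 μ fun t => (F t : Set X)) :
      BirkhoffIntegrableMulti μ F := h.birkhoffIntegrableMulti hμ_empty hμν hM hM0
  have hBS (h : BirkhoffIntegrableMulti μ F) :
      BirkhoffSimpleIntegrable 𝒞 μ fun t => (F t : Set X) := by
    obtain ⟨I, hI, hF⟩ := hlim h
    exact hF.birkhoffSimpleIntegrable hM h𝒞 hI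
  refine ⟨⟨hSB, hBS⟩, fun h => ?_, fun h => hBS (h.birkhoffIntegrableMulti hμ_empty hM hM0)⟩
  obtain ⟨I, hI, hF⟩ := hlim (hSB h)
  exact hF.gouldIntegrable hI
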